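/- Let $\Sigma$ be a finite alphabet. A generalized circular one-way jumping finite automaton over $\Sigma$ is a tuple $\mathcal A=(\Sigma,Q,q_0,F,R)$ with a finite state set $Q$, a starting state $q_0\in Q$, a set $F\subseteq Q$ of final states and a finite set $R\subseteq Q\times\Sigma^+\times Q$ of rules such that for all $p\in Q$, $w\in\Sigma^+$ there is at most one $q$ with $(p,w,q)\in R$ (from state $p$ the automaton may delete $w$ and go to state $q$). Put $\Sigma_p=\{w : (p,w,q)\in R \text{ for some } q\}$. Run as a right automaton (GRCOWJFA), for $(p,x,q)\in R$ and $u,v\in\Sigma^*$ it moves from the configuration $(p,uxv)$ to $(q,vu)$ provided that $u$ contains no word of $\Sigma_p$ as a subword and that $u_2x_1\neq x$ for every nonempty suffix $u_2$ of $u$ and every nonempty prefix $x_1$ of $x$. Run as a left automaton (GLCOWJFA), it moves from $(p,vxu)$ to $(q,uv)$ provided that $u$ contains no word of $\Sigma_p$ as a subword and that $x_2u_1\neq x$ for every nonempty suffix $x_2$ of $x$ and every nonempty prefix $u_1$ of $u$. In both modes the accepted language is the set of all $w\in\Sigma^*$ such that $(f,\lambda)$ is reachable from $(q_0,w)$ in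 finitely many moves for some $f\in F$, where $\lambda$ is the empty word. Let $\mathbf{GRCOWJ}$ and $\mathbf{GLCOWJ}$ be the classes of languages accepted by right and by left automata, respectively, and let $\mathbf{CS}$ be the class of context-sensitive languages, i.e. the languages $L(G)$ or $L(G)\cup\{\lambda\}$, where $G$ is a grammar all of whose (finitely many) productions $x\to y$ satisfy $|x|\le|y|$, with at least one nonterminal in $x$. Then $\mathbf{GRCOWJ}$ and $\mathbf{GLCOWJ}$ are proper subclasses of $\mathbf{CS}$: over every finite alphabet $\Sigma$, every language in $\mathbf{GRCOWJ}$ or in $\mathbf{GLCOWJ}$ is in $\mathbf{CS}$, and if $a\ne b$ are two letters of $\Sigma$, then the Dyck language of balanced words with opening symbol $a$ and closing symbol $b$, as a language over $\Sigma$, is in $\mathbf{CS}$ but neither in $\mathbf{GRCOWJ}$ nor in $\mathbf{GLCOWJ}$. In particular both inclusions are proper over every finite alphabet with at least two letters. -/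

import Mathlib

/-- A generalized circular one-way jumping finite automaton over the alphabet `α` with state set
`Q` (finiteness of `α` and `Q` is required where the classes of languages are formed).
A rule `(p, w, q)` means: from state `p`, go to state `q` deleting the nonempty word `w`.
The same data is run clockwise (`RightStep`) or anticlockwise (`LeftStep`). -/
structure GCOWJFA (α Q : Type) where
  /-- the starting state -/
  start : Q
  /-- the final states -/
  final : Set Q
  /-- the finitely many rules, as triples (source, deleted word, target) -/
  rules : Finset (Q × List α × Q)
  ne_nil : ∀ p w q, (p, w, q) ∈ rules → w ≠ []
  deterministic : ∀ p w q q', (p, w, q) ∈ rules → (p, w, q') ∈ rules → q = q'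

namespace GCOWJFA

variable {α Q : Type} (A : GCOWJFA α Q)

/-- The set `Σ_p` of the words that have a rule from the state `p`. -/
def deletable (p : Q) : Set (List α) := {w | ∃ q, (p, w, q) ∈ A.rules}

/-- The right circular jump `p u x v ↻ q v u`; the configuration `p w` is the pair `(p, w)`.
The jumped-over word `u` contains no word of `Σ_p` as a subword, and `x` is not the concatenation
of a nonempty suffix of `u` and a nonempty prefix of `x`. -/
def RightStep (c d : Q × List α) : Prop :=
  ∃ u x v : List α,
    (c.1, x, d.1) ∈ A.rules ∧ c.2 = u ++ x ++ v ∧ d.2 = v ++ u ∧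
    (∀ w ∈ A.deletable c.1, ¬ w <:+: u) ∧
    (∀ u₁ u₂ x₁ x₂ : List α, u = u₁ ++ u₂ → x = x₁ ++ x₂ → u₂ ≠ [] → x₁ ≠ [] → u₂ ++ x₁ ≠ x)

/-- The left circular jump from `v x u p` to `u v q`; the configuration `w p` is the pair `(p, w)`.
The jumped-over word `u` contains no word of `Σ_p` as a subword, and `x` is not the concatenation
of a nonempty suffix of `x` and a nonempty prefix of `u`. -/
def LeftStep (c d : Q × List α) : Prop :=
  ∃ u x v : List α,
    (c.1, x, d.1) ∈ A.rules ∧ c.2 = v ++ x ++ u ∧ d.2 = u ++ v ∧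
    (∀ w ∈ A.deletable c.1, ¬ w <:+: u) ∧
    (∀ u₁ u₂ x₁ x₂ : List α, u = u₁ ++ u₂ → x = x₁ ++ x₂ → u₁ ≠ [] → x₂ ≠ [] → x₂ ++ u₁ ≠ x)

/-- The language accepted by the automaton run as a right (clockwise) automaton. -/
def rightLanguage : Language α :=
  {w | ∃ f ∈ A.final, Relation.ReflTransGen A.RightStep (A.start, w) (f, [])}

/-- The language accepted by the automaton run as a left (anticlockwise) automaton. -/
def leftLanguage : Language α :=
  {w | ∃ f ∈ A.final, Relation.ReflTransGen A.LeftStep (A.start, w) (f, [])}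

end GCOWJFA

/-- The languages over `α` accepted by right automata with finitely many states. -/
def GRCOWJ (α : Type) : Set (Language α) :=
  {L | ∃ (Q : Type) (_ : Finite Q) (A : GCOWJFA α Q), A.rightLanguage = L}

/-- The languages over `α` accepted by left automata with finitely many states. -/
def GLCOWJ (α : Type) : Set (Language α) :=
  {L | ∃ (Q : Type) (_ : Finite Q) (A : GCOWJFA α Q), A.leftLanguage = L}

/-- A context-sensitive grammar with terminals `α`: finitely many productions `x → y` where `x`
contains a nonterminal and `|x| ≤ |y|`. As in `ContextFreeGrammar`, only the finitely many
nonterminals that occur in the productions matter, so `NT` itself need not be finite. -/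
structure ContextSensitiveGrammar (α : Type) where
  /-- the type of nonterminals -/
  NT : Type
  /-- the start symbol -/
  initial : NT
  /-- the productions, as pairs (left-hand side, right-hand side) -/
  rules : Finset (List (Symbol α NT) × List (Symbol α NT))
  exists_nonterminal : ∀ r ∈ rules, ∃ n : NT, Symbol.nonterminal n ∈ r.1
  length_le : ∀ r ∈ rules, r.1.length ≤ r.2.length

namespace ContextSensitiveGrammar

variable {α : Type} (g : ContextSensitiveGrammar α)

/-- One derivation step: replace one occurrence of the left-hand side of a production by its
right-hand side. -/
def Produces (s t : List (Symbol α g.NT)) : Prop :=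
  ∃ r ∈ g.rules, ∃ y z : List (Symbol α g.NT), s = y ++ r.1 ++ z ∧ t = y ++ r.2 ++ z

/-- The words of terminals that can be derived from the start symbol. -/
def language : Language α :=
  {w | Relation.ReflTransGen g.Produces [Symbol.nonterminal g.initial] (w.map Symbol.terminal)}

end ContextSensitiveGrammar

/-- The context-sensitive languages over `α`: with the usual convention on the empty word, which
such a grammar cannot generate, these are the languages `L(G)` and `L(G) ∪ {λ}` for a
context-sensitive grammar `G`. (In `Language α`, `+` is union and `1` is the language `{λ}`.) -/
def CS (α : Type) : Set (Language α) :=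
  {L | ∃ g : ContextSensitiveGrammar α, L = g.language ∨ L = g.language + 1}

/-- The Dyck language with opening symbol `a` and closing symbol `b`. -/
def dyckLanguage {α : Type} (a b : α) : Language α :=
  {w | ∃ d : DyckWord, w = d.toList.map fun s =>
    match s with
    | DyckStep.U => a
    | DyckStep.D => b}

/-! Inclusion in `CS`. A run of a right automaton is undone by string rewriting on letters and
boundedly many marks. To undo a step from `u x v` to `v u`, insert `x` at the front and carry
letters one by one from the end of the string to the front, until `u` stands before `x`.
Admissibility of `u` passes to its suffixes, and prolonging a suffix by one letter adds only
conditions visible in a window of bounded length (`jumpsOver_cons_window`), which a mark can store.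
Such a system gives a context-sensitive language (`mem_CS_of_rewriting`): when every mark is glued
to a letter, a string becomes a sequence of symbols containing one letter each. Its length is the
number of letters, and as rewriting never loses letters, the productions do not contract. The Dyck
language is treated by the same theorem, left automata by reversal.

The Dyck language is not accepted. Consider a word of many alternating blocks of `a` and `b`, all
long compared with the deleted words. A step deletes the leftmost occurrence of a word `x`, which
lies in the first block or at one of the next two block boundaries, and moves the blocks passed over
to the end. The same step works for other block lengths (`exists_deletion_of_rightStep`). Among the
first `2 * Nat.card Q + 1` stages of an accepting run, two agree in the state and in the letter of
the first block. Cutting out the part between them shows that a word is accepted whose blocks are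
rotated by an even number `μ` and slightly changed in length (`exists_rotation_mem_rightLanguage`).
If `μ = 0`, exactly one block has become shorter, and the letters no longer balance. If `μ > 0`,
start from `a^P (a^N b^N)^j b^P`: the rotation puts the block containing `b^P` before the one
containing `a^P`, so some prefix has too many `b`. -/

open Relation

/-! ### String rewriting and covers of a factor -/

section Rewriting

variable {Γ : Type}

/-- One step of the string rewriting system with rules `P`. -/
def RewriteStep (P : List Γ → List Γ → Prop) (g g' : List Γ) : Prop :=
  ∃ l r y z, P l r ∧ g = y ++ l ++ z ∧ g' = y ++ r ++ z

theorem RewriteStep.append {P : List Γ → List Γ → Prop} {g g' : List Γ} (h : RewriteStep P g g')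
    (y z : List Γ) : RewriteStep P (y ++ g ++ z) (y ++ g' ++ z) := by
  obtain ⟨l, r, y', z', hP, rfl, rfl⟩ := h
  exact ⟨l, r, y ++ y', z' ++ z, hP, by simp, by simp⟩

theorem RewriteStep.of_rule {P : List Γ → List Γ → Prop} {l r : List Γ} (h : P l r) :
    RewriteStep P l r := ⟨l, r, [], [], h, by simp, by simp⟩

theorem reflTransGen_rewriteStep_append {P : List Γ → List Γ → Prop} {g g' : List Γ}
    (h : ReflTransGen (RewriteStep P) g g') (y z : List Γ) :
    ReflTransGen (RewriteStep P) (y ++ g ++ z) (y ++ g' ++ z) :=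
  h.lift (fun t => y ++ t ++ z) fun _ _ hs => hs.append y z

theorem exists_cover_of_flatMap_eq_append {σ : Type} {f : σ → List Γ} (F : List σ) (l z : List Γ)
    (hF : ∀ s ∈ F, f s ≠ []) (h : F.flatMap f = l ++ z) :
    ∃ M F₂ z', F = M ++ F₂ ∧ M.flatMap f = l ++ z' ∧ z = z' ++ F₂.flatMap f ∧
      M.length ≤ l.length := by
  induction F generalizing l with
  | nil =>
    simp only [List.flatMap_nil, List.nil_eq, List.append_eq_nil_iff] at h
    exact ⟨[], [], [], by simp [h]⟩
  | cons s F ih =>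
    rcases eq_or_ne l [] with rfl | hl
    · exact ⟨[], s :: F, [], by simpa using h.symm⟩
    rw [List.flatMap_cons, List.append_eq_append_iff] at h
    rcases h with ⟨a, rfl, h⟩ | ⟨c, hs, rfl⟩
    · obtain ⟨M, F₂, z', rfl, hM, rfl, hlen⟩ := ih a (fun t ht => hF t (by simp [ht])) h
      have : 0 < (f s).length := List.length_pos_iff.2 (hF s (by simp))
      exact ⟨s :: M, F₂, z', by simp, by simp [hM], rfl, by simp; omega⟩
    · have : 0 < l.length := List.length_pos_iff.2 hl
      exact ⟨[s], F, c, by simp, by simp [hs], rfl, by simp; omega⟩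

/-- As no image is empty, the factor `l` meets at most `l.length` of them. This bounds the left-hand
sides of the productions that simulate a rewriting step. -/
theorem exists_cover_of_flatMap_eq {σ : Type} {f : σ → List Γ} (F : List σ) (y l z : List Γ)
    (hF : ∀ s ∈ F, f s ≠ []) (hl : l ≠ []) (h : F.flatMap f = y ++ l ++ z) :
    ∃ F₁ M F₂ y' z', F = F₁ ++ M ++ F₂ ∧ M.flatMap f = y' ++ l ++ z' ∧ y = F₁.flatMap f ++ y' ∧
      z = z' ++ F₂.flatMap f ∧ M.length ≤ l.length := by
  induction F generalizing y with
  | nil => simp [hl] at h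
  | cons s F ih =>
    have ih := fun y => ih y fun t ht => hF t (by simp [ht])
    rw [List.flatMap_cons, List.append_assoc, List.append_eq_append_iff] at h
    rcases h with ⟨a, rfl, h⟩ | ⟨c, hs, h⟩
    · obtain ⟨F₁, M, F₂, y', z', rfl, hM, rfl, rfl, hlen⟩ := ih a (by simpa using h)
      exact ⟨s :: F₁, M, F₂, y', z', by simp, hM, by simp, rfl, hlen⟩
    -- If `c` is empty, the image of `s` ends exactly where `l` begins, so `s` belongs to `F₁` and
    -- not to the cover.
    · rcases eq_or_ne c [] with rfl | hc
      · obtain ⟨F₁, M, F₂, y', z', rfl, hM, hy, rfl, hlen⟩ := ih [] (by simpa using h.symm)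
        refine ⟨s :: F₁, M, F₂, y', z', by simp, hM, ?_, rfl, hlen⟩
        simp only [List.append_nil] at hs
        rw [← hs, List.flatMap_cons, List.append_assoc, ← hy, List.append_nil]
      · rw [List.append_eq_append_iff] at h
        have hcl := List.length_pos_iff.2 hc
        rcases h with ⟨c', rfl, rfl⟩ | ⟨a, rfl, h⟩
        · exact ⟨[], [s], F, y, c', by simp, by simp [hs], by simp, rfl, by
            simp [Nat.one_le_iff_ne_zero, hl]⟩
        · obtain ⟨M, F₂, z', rfl, hM, rfl, hlen⟩ :=
            exists_cover_of_flatMap_eq_append F a z (fun t ht => hF t (by simp [ht])) h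
          exact ⟨[], s :: M, F₂, y, z', by simp, by simp [hM, hs], by simp, rfl, by simp; omega⟩

end Rewriting

/-! ### Grammar symbols that carry one letter and some marks -/

section Clusters

variable (α N : Type) (K : ℕ)

/-- Strings with exactly one letter (`Sum.inl`) and between `1` and `K` marks (`Sum.inr`). -/
abbrev Cluster : Type :=
  {B : List (α ⊕ N) // (B.countP Sum.isLeft = 1 ∧ B.length ≤ K + 1) ∧ ∃ n, Sum.inr n ∈ B}

instance [Finite α] [Finite N] : Finite (Cluster α N K) :=
  ((List.finite_length_le (α ⊕ N) (K + 1)).subset fun _ h => h.1.2).to_subtype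

variable {α N K}

/-- The string for which a grammar symbol stands; the start symbol `none` stands for `g₀`. -/
def expandSymbol (g₀ : List (α ⊕ N)) : Symbol α (Option (Cluster α N K)) → List (α ⊕ N)
  | .terminal a => [.inl a]
  | .nonterminal none => g₀
  | .nonterminal (some B) => B.1

theorem flatMap_expandSymbol_terminal (g₀ : List (α ⊕ N)) (w : List α) :
    (w.map Symbol.terminal : List (Symbol α (Option (Cluster α N K)))).flatMap (expandSymbol g₀) =
      w.map Sum.inl := by
  induction w with
  | nil => rfl
  | cons a w ih => simp [expandSymbol, ih]

theorem countP_isLeft_add_countP_isRight (g : List (α ⊕ N)) :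
    g.countP Sum.isLeft + g.countP Sum.isRight = g.length := by
  induction g with
  | nil => rfl
  | cons s g ih => cases s <;> simp [List.countP_cons] <;> omega

theorem countP_isLeft_flatMap {g₀ : List (α ⊕ N)} (F : List (Symbol α (Option (Cluster α N K))))
    (hF : ∀ s ∈ F, (expandSymbol g₀ s).countP Sum.isLeft = 1) :
    (F.flatMap (expandSymbol g₀)).countP Sum.isLeft = F.length := by
  induction F with
  | nil => rfl
  | cons s F ih =>
    simp only [List.flatMap_cons, List.countP_append, List.length_cons]
    rw [hF s (by simp), ih fun t ht => hF t (by simp [ht]), add_comm]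

/-- A cluster contains a mark and the start symbol expands to no letter, so only terminals can
expand to a word of letters. -/
theorem eq_map_terminal_of_flatMap_eq {g₀ : List (α ⊕ N)}
    (hg₀ : g₀.countP Sum.isLeft = 0) (F : List (Symbol α (Option (Cluster α N K)))) (w : List α)
    (hF : ∀ s ∈ F, (expandSymbol g₀ s).countP Sum.isLeft = 1)
    (h : F.flatMap (expandSymbol g₀) = w.map Sum.inl) : F = w.map Symbol.terminal := by
  induction F generalizing w with
  | nil => simpa using h.symm
  | cons s F ih =>
    have hs := hF s (by simp)
    have hno : ∀ n, Sum.inr n ∉ expandSymbol g₀ s := fun n hn => by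
      have : Sum.inr n ∈ (s :: F).flatMap (expandSymbol g₀) := by simp [hn]
      simp [h] at this
    rcases s with a | _ | B
    · rcases w with _ | ⟨b, w⟩
      · simp [expandSymbol] at h
      · simp only [List.flatMap_cons, expandSymbol, List.singleton_append, List.map_cons,
          List.cons.injEq, Sum.inl.injEq] at h
        rw [List.map_cons, h.1, ih w (fun t ht => hF t (by simp [ht])) h.2]
    · simp [expandSymbol, hg₀] at hs
    · obtain ⟨n, hn⟩ := B.2.2
      exact absurd hn (hno n)

/-- Each mark is attached to the next letter, and the marks after the last letter to that letter. No
cluster receives more than `K` marks because the whole string has no more. -/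
theorem exists_clusters (g₀ g : List (α ⊕ N)) (hpos : 0 < g.countP Sum.isLeft)
    (hK : g.countP Sum.isRight ≤ K) :
    ∃ M : List (Symbol α (Option (Cluster α N K))),
      (∀ s ∈ M, (expandSymbol g₀ s).countP Sum.isLeft = 1) ∧ M.flatMap (expandSymbol g₀) = g := by
  induction g with
  | nil => simp at hpos
  | cons s g ih =>
    have hlen := countP_isLeft_add_countP_isRight g
    rcases s with c | n
    · simp at hK
      rcases g with _ | ⟨s, g⟩
      · exact ⟨[.terminal c], by simp [expandSymbol], by simp [expandSymbol]⟩
      rcases Nat.eq_zero_or_pos ((s :: g).countP Sum.isLeft) with h0 | h0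
      · rcases s with d | n
        · simp [List.countP_cons] at h0
        refine ⟨[.nonterminal (some ⟨Sum.inl c :: Sum.inr n :: g, ⟨?_, ?_⟩, n, by simp⟩)], ?_, ?_⟩
        · rw [List.countP_cons, h0]; rfl
        · rw [List.length_cons]; omega
        · simp only [List.mem_singleton, forall_eq, expandSymbol]
          rw [List.countP_cons, h0]; rfl
        · simp [expandSymbol]
      · obtain ⟨M, hM, hg⟩ := ih h0 (by simpa [List.countP_cons] using hK)
        exact ⟨.terminal c :: M, by simpa [expandSymbol] using hM, by simp [expandSymbol, hg]⟩
    · simp [List.countP_cons] at hK hpos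
      obtain ⟨M, hM, hg⟩ := ih (by simpa using hpos) (by omega)
      rcases M with _ | ⟨s, M⟩
      · simp at hg; subst hg; simp at hpos
      have hs := hM s (by simp)
      have hlen' := countP_isLeft_add_countP_isRight (expandSymbol g₀ s)
      have hle : (expandSymbol g₀ s).countP Sum.isRight ≤ g.countP Sum.isRight := by
        rw [← hg]; simp
      refine ⟨.nonterminal (some ⟨Sum.inr n :: expandSymbol g₀ s, ⟨?_, ?_⟩, n, by simp⟩) :: M,
        ?_, ?_⟩
      · simpa [List.countP_cons] using hs
      · simp; omega
      · intro t ht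
        rcases List.mem_cons.1 ht with rfl | ht
        · simpa [expandSymbol, List.countP_cons] using hs
        · exact hM t (by simp [ht])
      · simpa [expandSymbol] using hg

/-- The noncontracting pairs of symbol strings of length at most `C` that contain a nonterminal on
the left and are related by rewriting, once expanded. -/
def ClusterRule (P : List (α ⊕ N) → List (α ⊕ N) → Prop) (g₀ : List (α ⊕ N)) (K C : ℕ)
    (l r : List (Symbol α (Option (Cluster α N K)))) : Prop :=
  (l.length ≤ C ∧ r.length ≤ C) ∧ l.length ≤ r.length ∧ (∃ n, Symbol.nonterminal n ∈ l) ∧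
    ReflTransGen (RewriteStep P) (l.flatMap (expandSymbol g₀)) (r.flatMap (expandSymbol g₀))

theorem finite_clusterRule [Finite α] [Finite N] (P : List (α ⊕ N) → List (α ⊕ N) → Prop)
    (g₀ : List (α ⊕ N)) (K C : ℕ) :
    {r : List (Symbol α (Option (Cluster α N K))) × List (Symbol α (Option (Cluster α N K))) |
      ClusterRule P g₀ K C r.1 r.2}.Finite := by
  have : Finite (Symbol α (Option (Cluster α N K))) :=
    Finite.of_surjective (Sum.elim Symbol.terminal Symbol.nonterminal) (by
      rintro (a | n)
      exacts [⟨.inl a, rfl⟩, ⟨.inr n, rfl⟩])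
  exact ((List.finite_length_le _ C).prod (List.finite_length_le _ C)).subset fun _ h => h.1

/-- The grammar with the productions `ClusterRule`. -/
noncomputable def rewritingGrammar [Finite α] [Finite N] (P : List (α ⊕ N) → List (α ⊕ N) → Prop)
    (g₀ : List (α ⊕ N)) (K C : ℕ) : ContextSensitiveGrammar α where
  NT := Option (Cluster α N K)
  initial := none
  rules := (finite_clusterRule P g₀ K C).toFinset
  exists_nonterminal := fun _ hr => ((Set.Finite.mem_toFinset _).1 hr).2.2.1
  length_le := fun _ hr => ((Set.Finite.mem_toFinset _).1 hr).2.1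

theorem mem_language_rewritingGrammar [Finite α] [Finite N]
    {P : List (α ⊕ N) → List (α ⊕ N) → Prop} {g₀ : List (α ⊕ N)} {K C : ℕ} {w : List α} :
    w ∈ (rewritingGrammar P g₀ K C).language ↔
      ReflTransGen (RewriteStep (ClusterRule P g₀ K C)) [.nonterminal none]
        (w.map .terminal) := by
  have : (rewritingGrammar P g₀ K C).Produces = RewriteStep (ClusterRule P g₀ K C) := by
    ext s t
    constructor
    · rintro ⟨r, hr, y, z, rfl, rfl⟩
      exact ⟨r.1, r.2, y, z, (finite_clusterRule P g₀ K C).mem_toFinset.1 hr, rfl, rfl⟩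
    · rintro ⟨l, r, y, z, h, rfl, rfl⟩
      exact ⟨(l, r), (finite_clusterRule P g₀ K C).mem_toFinset.2 h, y, z, rfl, rfl⟩
  rw [← this]
  rfl

end Clusters

/-! ### From bounded rewriting to context-sensitive grammars -/

theorem ContextSensitiveGrammar.nil_notMem_language {α : Type} (g : ContextSensitiveGrammar α) :
    [] ∉ g.language := by
  intro h
  have key : ∀ t, ReflTransGen g.Produces [Symbol.nonterminal g.initial] t → 0 < t.length := by
    intro t ht
    induction ht with
    | refl => simp
    | tail _ hs ih =>
      obtain ⟨r, hr, y, z, rfl, rfl⟩ := hs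
      have := g.length_le r hr
      simp at ih ⊢
      omega
  simpa using key _ h

/-- Languages recognized by linearly bounded rewriting are context-sensitive: the rewriting system
acts on strings of letters and marks, never lowers the number of letters, and the strings reachable
from the initial string of marks have a bounded number of marks. -/
theorem mem_CS_of_rewriting {α N : Type} [Finite α] [Finite N]
    (P : List (α ⊕ N) → List (α ⊕ N) → Prop) (g₀ : List (α ⊕ N)) (B K : ℕ)
    (hg₀ : g₀.countP Sum.isLeft = 0)
    (hlen : ∀ l r, P l r → l.length ≤ B ∧ r.length ≤ B)
    (hletters : ∀ l r, P l r → l.countP Sum.isLeft ≤ r.countP Sum.isLeft)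
    (hmark : ∀ l r, P l r → ∃ n, Sum.inr n ∈ l)
    (hK : ∀ g, ReflTransGen (RewriteStep P) g₀ g → g.countP Sum.isRight ≤ K) :
    ({w | ReflTransGen (RewriteStep P) g₀ (w.map Sum.inl)} : Language α) ∈ CS α := by
  -- A left-hand side of length at most `B` is covered by at most `B` symbols, whose expansions have
  -- total length at most `B * (K + 1)`. After the step this stretch has at most `B * (K + 1) + B`
  -- letters, hence as many symbols.
  set C := B * (K + 1) + B + K + 1 with hC
  set R := RewriteStep (ClusterRule P g₀ K C) with hR
  have sound : ∀ F, ReflTransGen R [.nonterminal none] F →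
      ReflTransGen (RewriteStep P) g₀ (F.flatMap (expandSymbol g₀)) := by
    intro F hF
    induction hF with
    | refl => simp [expandSymbol, ReflTransGen.refl]
    | tail _ hs ih =>
      obtain ⟨l, r, y, z, hr, rfl, rfl⟩ := hs
      have := reflTransGen_rewriteStep_append hr.2.2.2 (y.flatMap (expandSymbol g₀))
        (z.flatMap (expandSymbol g₀))
      simp only [List.flatMap_append] at ih ⊢
      exact ih.trans this
  have complete : ∀ g, ReflTransGen (RewriteStep P) g₀ g → 0 < g.countP Sum.isLeft →
      ∃ F : List (Symbol α (Option (Cluster α N K))),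
        (∀ s ∈ F, (expandSymbol g₀ s).countP Sum.isLeft = 1) ∧
        F.flatMap (expandSymbol g₀) = g ∧
        ReflTransGen R [.nonterminal none] F := by
    intro g hg
    induction hg with
    | refl => intro h; omega
    | @tail g g' hg hs ih =>
      intro hpos
      have hK' := hK g' (hg.tail hs)
      -- Strings without letters cannot be split into clusters. The whole derivation up to the first
      -- letter is therefore one production from the start symbol; its letters all come from a
      -- single right-hand side.
      rcases Nat.eq_zero_or_pos (g.countP Sum.isLeft) with h0 | h0
      · obtain ⟨M, hM, hMg⟩ := exists_clusters (K := K) g₀ g' hpos hK'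
        have hMlen := countP_isLeft_flatMap M hM
        refine ⟨M, hM, hMg, ReflTransGen.single (RewriteStep.of_rule
          ⟨⟨?_, ?_⟩, ?_, ⟨none, by simp⟩, ?_⟩)⟩
        · simp [hC]
        · have hle : g'.countP Sum.isLeft ≤ B := by
            obtain ⟨l, r, y, z, hP, rfl, rfl⟩ := hs
            have := (hlen _ _ hP).2
            have h3 : r.countP Sum.isLeft ≤ r.length := List.countP_le_length
            simp only [List.countP_append] at h0 ⊢
            omega
          rw [hMg] at hMlen
          omega
        · rw [hMg] at hMlen
          rw [List.length_singleton]
          omega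
        · rw [hMg]
          simpa [expandSymbol] using hg.tail hs
      · obtain ⟨F, hF, rfl, hder⟩ := ih h0
        obtain ⟨l, r, y, z, hP, hg1, rfl⟩ := hs
        obtain ⟨n, hn⟩ := hmark _ _ hP
        have hne : ∀ s ∈ F, expandSymbol g₀ s ≠ [] := fun s hs h => by
          have := hF s hs
          simp [h] at this
        obtain ⟨F₁, M, F₂, y', z', rfl, hM, rfl, rfl, hMl⟩ :=
          exists_cover_of_flatMap_eq F y l z hne (List.ne_nil_of_mem hn) hg1
        have hMF : ∀ s ∈ M, (expandSymbol g₀ s).countP Sum.isLeft = 1 := fun s hs =>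
          hF s (by simp [hs])
        have hMlen := countP_isLeft_flatMap M hMF
        have hMlen2 : (M.flatMap (expandSymbol g₀)).length ≤ M.length * (K + 1) := by
          rw [List.length_flatMap]
          refine (List.sum_le_card_nsmul _ (K + 1) ?_).trans (by simp)
          intro x hx
          obtain ⟨s, hs, rfl⟩ := List.mem_map.1 hx
          rcases s with a | _ | B
          · simp [expandSymbol]
          · have := hMF _ hs
            simp [expandSymbol, hg₀] at this
          · exact B.2.1.2
        have hlet := hletters _ _ hP
        obtain ⟨hlB, hrB⟩ := hlen _ _ hP
        have hMpos : 0 < M.length := by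
          rcases M with _ | ⟨s, M⟩
          · simp [List.ne_nil_of_mem hn] at hM
          · simp
        rw [hM] at hMlen hMlen2
        simp only [List.countP_append, List.length_append] at hMlen hMlen2 hK'
        obtain ⟨M', hM', hMg⟩ := exists_clusters (K := K) g₀ (y' ++ r ++ z')
          (by simp only [List.countP_append]; omega) (by simp only [List.countP_append]; omega)
        have hMlen' := countP_isLeft_flatMap M' hM'
        rw [hMg] at hMlen'
        simp only [List.countP_append] at hMlen'
        have hb : M.length * (K + 1) ≤ B * (K + 1) := Nat.mul_le_mul_right _ (by omega)
        have e1 : y'.countP Sum.isLeft ≤ y'.length := List.countP_le_length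
        have e2 : z'.countP Sum.isLeft ≤ z'.length := List.countP_le_length
        have e3 : r.countP Sum.isLeft ≤ r.length := List.countP_le_length
        refine ⟨F₁ ++ M' ++ F₂, ?_, by simp [hMg], hder.tail ⟨M, M', F₁, F₂,
          ⟨⟨?_, ?_⟩, ?_, ?_, ?_⟩, rfl, rfl⟩⟩
        · intro s hs
          simp only [List.mem_append] at hs
          rcases hs with (hs | hs) | hs
          · exact hF s (by simp [hs])
          · exact hM' s hs
          · exact hF s (by simp [hs])
        · omega
        · omega
        · omega
        -- The mark in `l` lies in the expansion of some symbol of `M`, and that symbol cannot be a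
        -- terminal.
        · by_contra hcon
          push Not at hcon
          have : Sum.inr n ∈ M.flatMap (expandSymbol g₀) := by rw [hM]; simp [hn]
          obtain ⟨s, hs, hns⟩ := List.mem_flatMap.1 this
          rcases s with a | m
          · simp [expandSymbol] at hns
          · exact hcon m hs
        · rw [hM, hMg]
          exact ReflTransGen.single ((RewriteStep.of_rule hP).append y' z')
  have hlang : ∀ w : List α, w ∈ (rewritingGrammar P g₀ K C).language ↔
      w ≠ [] ∧ ReflTransGen (RewriteStep P) g₀ (w.map Sum.inl) := by
    intro w
    constructor
    · intro hw
      refine ⟨fun h => ContextSensitiveGrammar.nil_notMem_language _ (h ▸ hw), ?_⟩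
      have := sound _ (mem_language_rewritingGrammar.1 hw)
      rwa [flatMap_expandSymbol_terminal] at this
    · rintro ⟨hne, hw⟩
      obtain ⟨F, hF, hFw, hder⟩ := complete _ hw (by
        have := List.length_pos_iff.2 hne
        simpa [List.countP_map, Function.comp_def] using this)
      exact mem_language_rewritingGrammar.2 (eq_map_terminal_of_flatMap_eq hg₀ F w hF hFw ▸ hder)
  refine ⟨rewritingGrammar P g₀ K C, ?_⟩
  -- The grammar yields exactly the nonempty words; the empty word is adjoined if the rewriting
  -- system reaches it.
  by_cases hnil : ReflTransGen (RewriteStep P) g₀ ([].map Sum.inl)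
  · right
    ext w
    rw [Language.mem_add, hlang, Language.mem_one]
    constructor
    · intro hw
      by_cases hw0 : w = []
      · exact Or.inr hw0
      · exact Or.inl ⟨hw0, hw⟩
    · rintro (hw | rfl)
      exacts [hw.2, hnil]
  · left
    ext w
    rw [hlang]
    constructor
    · intro hw
      exact ⟨fun h => hnil (h ▸ hw), hw⟩
    · exact fun h => h.2

/-! ### The condition on the jumped-over word, one letter at a time -/

section JumpCondition

variable {α : Type}

/-- The condition on the word `u` jumped over by a right automaton when it deletes `x` in a state
from which the words in `D` are deletable. -/
def JumpsOver (D : Set (List α)) (x u : List α) : Prop :=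
  (∀ w ∈ D, ¬ w <:+: u) ∧
    ∀ u₁ u₂ x₁ x₂ : List α, u = u₁ ++ u₂ → x = x₁ ++ x₂ → u₂ ≠ [] → x₁ ≠ [] → u₂ ++ x₁ ≠ x

theorem jumpsOver_nil {D : Set (List α)} {x : List α} (hD : [] ∉ D) : JumpsOver D x [] := by
  refine ⟨fun w hw h => ?_, fun u₁ u₂ x₁ x₂ hu _ hne _ => ?_⟩
  · rw [List.infix_nil] at h
    exact hD (h ▸ hw)
  · simp at hu
    exact absurd hu.2 hne

/-- As `x` is itself deletable, the ban on `x` as a factor of `u` and the ban on overlaps together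
say that `x` does not begin at any position of `u` in `u ++ x`. A new first letter adds just one
position to be tested. -/
theorem jumpsOver_cons {D : Set (List α)} {x : List α} (hx : x ∈ D) (c : α) (u : List α) :
    JumpsOver D x (c :: u) ↔
      JumpsOver D x u ∧ (∀ w ∈ D, ¬ w <+: c :: u) ∧ ¬ x <+: (c :: u) ++ x := by
  constructor
  · rintro ⟨h1, h2⟩
    refine ⟨⟨fun w hw h => h1 w hw (List.infix_cons_iff.2 (.inr h)), ?_⟩,
      fun w hw h => h1 w hw (List.infix_cons_iff.2 (.inl h)), fun h => ?_⟩
    · rintro u₁ u₂ x₁ x₂ rfl hx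
      exact h2 (c :: u₁) u₂ x₁ x₂ rfl hx
    · obtain ⟨x₂, h⟩ := h
      rcases List.append_eq_append_iff.1 h with ⟨t, ht, -⟩ | ⟨t, ht, hx₂⟩
      · exact h1 x hx ⟨[], t, by simp [ht]⟩
      · rcases eq_or_ne t [] with rfl | hne
        · exact h1 x hx (by simp [ht])
        · exact h2 [] (c :: u) t x₂ rfl hx₂ (by simp) hne ht.symm
  · rintro ⟨⟨h1, h2⟩, h3, h4⟩
    refine ⟨fun w hw h => (List.infix_cons_iff.1 h).elim (h3 w hw) (h1 w hw), ?_⟩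
    rintro u₁ u₂ x₁ x₂ hu hx hu₂ hx₁ hov
    rcases u₁ with _ | ⟨d, u₁⟩
    · simp only [List.nil_append] at hu
      subst hu
      exact h4 ⟨x₂, by rw [← hov, List.append_assoc, hov, ← hx]⟩
    · simp only [List.cons_append, List.cons.injEq] at hu
      exact h2 u₁ u₂ x₁ x₂ hu.2 hx hu₂ hx₁ hov

theorem prefix_cons_take_iff {m : ℕ} {w u : List α} (c : α) (hw : w.length ≤ m) :
    w <+: c :: u.take m ↔ w <+: c :: u := by
  rw [← List.take_succ_cons, List.prefix_take_iff]
  exact and_iff_left (by omega)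

/-- Either `u` is not truncated at all, or the truncated word is already longer than `x` and the
appended copy of `x` plays no part. -/
theorem prefix_cons_take_append_iff {m : ℕ} {x u : List α} (c : α) (hx : x.length ≤ m) :
    x <+: (c :: u.take m) ++ x ↔ x <+: (c :: u) ++ x := by
  rcases le_total u.length m with hu | hu
  · rw [List.take_of_length_le hu]
  · have h1 : ∀ y : List α, x.length ≤ y.length → (x <+: y ++ x ↔ x <+: y) := fun y hy =>
      ⟨fun h => List.prefix_of_prefix_length_le h (List.prefix_append y x) hy,
        fun h => h.trans (List.prefix_append y x)⟩
    rw [h1 _ (by simp; omega), h1 _ (by simp; omega), prefix_cons_take_iff c hx]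

end JumpCondition

/-! ### Running a right automaton backwards by rewriting -/

namespace GCOWJFA

variable {α Q : Type} (A : GCOWJFA α Q)

theorem rightStep_iff {c d : Q × List α} : A.RightStep c d ↔ ∃ u x v : List α,
    (c.1, x, d.1) ∈ A.rules ∧ c.2 = u ++ x ++ v ∧ d.2 = v ++ u ∧
      JumpsOver (A.deletable c.1) x u := Iff.rfl

theorem nil_notMem_deletable (p : Q) : [] ∉ A.deletable p := fun ⟨q, hq⟩ => A.ne_nil p [] q hq rfl

/-- A bound for the lengths of the deleted words. -/
def ruleBound : ℕ := A.rules.sup fun r => r.2.1.length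

theorem length_le_ruleBound {r : Q × List α × Q} (hr : r ∈ A.rules) :
    r.2.1.length ≤ A.ruleBound :=
  Finset.le_sup (f := fun r : Q × List α × Q => r.2.1.length) hr

theorem length_le_of_mem_deletable {p : Q} {w : List α} (hw : w ∈ A.deletable p) :
    w.length ≤ A.ruleBound := A.length_le_ruleBound hw.choose_spec

/-- Marks of the rewriting system that runs a right automaton backwards. In the state `idle q` the
string spells a word accepted from `q`. In the state `scan r W`, a rule `r` is being undone: the
letters before the deleted word are the jumped-over word found so far, which starts with `W`, and
`hash` follows the deleted word. The marks `right`, `pick`, `back` and `fin` are the moving heads,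
and `endMark` is the end of the string. -/
inductive JumpMark : Type
  | init | idle (q : Q) | scan (r : A.rules) (W : {W : List α // W.length ≤ A.ruleBound})
  | hash | right | pick | back | fin | endMark

instance [Finite α] [Finite Q] : Finite A.JumpMark := by
  have : Finite {W : List α // W.length ≤ A.ruleBound} :=
    (List.finite_length_le α A.ruleBound).to_subtype
  let f : Fin 7 ⊕ Q ⊕ (A.rules × {W : List α // W.length ≤ A.ruleBound}) → A.JumpMark
    | .inl i => ![.init, .hash, .right, .pick, .back, .fin, .endMark] i
    | .inr (.inl q) => .idle q
    | .inr (.inr (r, W)) => .scan r W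
  refine Finite.of_surjective f ?_
  rintro (_ | q | ⟨r, W⟩ | _ | _ | _ | _ | _ | _)
  exacts [⟨.inl 0, rfl⟩, ⟨.inr (.inl q), rfl⟩, ⟨.inr (.inr (r, W)), rfl⟩, ⟨.inl 1, rfl⟩,
    ⟨.inl 2, rfl⟩, ⟨.inl 3, rfl⟩, ⟨.inl 4, rfl⟩, ⟨.inl 5, rfl⟩, ⟨.inl 6, rfl⟩]

open JumpMark Sum

/-- The first letters of a word, as stored in the mark `scan`. -/
def window (u : List α) : {W : List α // W.length ≤ A.ruleBound} :=
  ⟨u.take A.ruleBound, List.length_take_le _ _⟩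

/-- The rules of the rewriting system that runs a right automaton backwards. -/
inductive JumpRule : List (α ⊕ A.JumpMark) → List (α ⊕ A.JumpMark) → Prop
  | init (f : Q) : f ∈ A.final → JumpRule [inr init] [inr (idle f), inr endMark]
  | insert (r : A.rules) : JumpRule [inr (idle r.1.2.2)]
      (inr (scan r (A.window [])) :: r.1.2.1.map inl ++ [inr hash, inr right])
  | right (d : α ⊕ A.JumpMark) : JumpRule [inr right, d] [d, inr right]
  | pick (c : α) : JumpRule [inl c, inr right, inr endMark] [inr pick, inl c, inr endMark]
  | carry (d : α ⊕ A.JumpMark) (c : α) : (∀ r W, d ≠ inr (scan r W)) →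
      JumpRule [d, inr pick, inl c] [inr pick, inl c, d]
  | drop (r : A.rules) (W : {W : List α // W.length ≤ A.ruleBound}) (c : α) :
      (∀ w ∈ A.deletable r.1.1, ¬ w <+: c :: W.1) → ¬ r.1.2.1 <+: (c :: W.1) ++ r.1.2.1 →
      JumpRule [inr (scan r W), inr pick, inl c] [inr (scan r (A.window (c :: W.1))), inl c,
        inr right]
  | turn : JumpRule [inr hash, inr right] [inr back]
  | back (d : α ⊕ A.JumpMark) : (∀ r W, d ≠ inr (scan r W)) →
      JumpRule [d, inr back] [inr back, d]
  | land (r : A.rules) (W : {W : List α // W.length ≤ A.ruleBound}) :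
      JumpRule [inr (scan r W), inr back] [inr (idle r.1.1)]
  | fin : JumpRule [inr (idle A.start)] [inr fin]
  | sweep (d : α ⊕ A.JumpMark) : JumpRule [inr fin, d] [d, inr fin]
  | endMark : JumpRule [inr fin, inr endMark] []

/-- The word `w` is accepted from the state `q` of the right automaton. -/
def RightAccepts (q : Q) (w : List α) : Prop :=
  ∃ f ∈ A.final, ReflTransGen A.RightStep (q, w) (f, [])

/-- The stored window can be updated without knowing the rest of `u`. -/
theorem window_cons_window (c : α) (u : List α) :
    A.window (c :: (A.window u).1) = A.window (c :: u) := by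
  simp only [window, Subtype.mk.injEq]
  rcases A.ruleBound with _ | m
  · simp
  · simp [List.take_take]

theorem jumpsOver_cons_window (r : A.rules) (c : α) (u : List α) :
    JumpsOver (A.deletable r.1.1) r.1.2.1 (c :: u) ↔ JumpsOver (A.deletable r.1.1) r.1.2.1 u ∧
      (∀ w ∈ A.deletable r.1.1, ¬ w <+: c :: (A.window u).1) ∧
      ¬ r.1.2.1 <+: (c :: (A.window u).1) ++ r.1.2.1 := by
  have hr : r.1.2.1 ∈ A.deletable r.1.1 := ⟨r.1.2.2, r.2⟩
  rw [jumpsOver_cons hr, window, prefix_cons_take_append_iff c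
    (A.length_le_ruleBound r.2)]
  refine and_congr_right fun _ => and_congr_left fun _ => forall₂_congr fun w hw => ?_
  rw [prefix_cons_take_iff c (A.length_le_of_mem_deletable hw)]

/-- The strings that occur when a right automaton is run backwards by `JumpRule`. -/
inductive JumpForm : List (α ⊕ A.JumpMark) → Prop
  | init : JumpForm [inr init]
  | idle (q : Q) (w : List α) : A.RightAccepts q w →
      JumpForm (inr (idle q) :: (w.map inl ++ [inr endMark]))
  | right (r : A.rules) (u v : List α) (X Y : List (α ⊕ A.JumpMark)) :
      A.RightAccepts r.1.2.2 (v ++ u) → JumpsOver (A.deletable r.1.1) r.1.2.1 u →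
      X ++ Y = u.map inl ++ r.1.2.1.map inl ++ inr hash :: (v.map inl ++ [inr endMark]) →
      JumpForm (inr (scan r (A.window u)) :: (X ++ inr right :: Y))
  | pick (r : A.rules) (u v : List α) (c : α) (X Y : List (α ⊕ A.JumpMark)) :
      A.RightAccepts r.1.2.2 (v ++ c :: u) → JumpsOver (A.deletable r.1.1) r.1.2.1 u →
      X ++ Y = u.map inl ++ r.1.2.1.map inl ++ inr hash :: (v.map inl ++ [inr endMark]) →
      JumpForm (inr (scan r (A.window u)) :: (X ++ inr pick :: inl c :: Y))
  | back (r : A.rules) (u v : List α) (X Y : List (α ⊕ A.JumpMark)) :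
      A.RightAccepts r.1.2.2 (v ++ u) → JumpsOver (A.deletable r.1.1) r.1.2.1 u →
      X ++ Y = u.map inl ++ r.1.2.1.map inl ++ (v.map inl ++ [inr endMark]) →
      JumpForm (inr (scan r (A.window u)) :: (X ++ inr back :: Y))
  | fin (w : List α) (X Y : List (α ⊕ A.JumpMark)) : A.RightAccepts A.start w →
      X ++ Y = w.map inl ++ [inr endMark] → JumpForm (X ++ inr fin :: Y)
  | done (w : List α) : A.RightAccepts A.start w → JumpForm (w.map inl)

variable {A}

theorem inr_notMem_of_append_eq {X Y Z : List (α ⊕ A.JumpMark)} {n : A.JumpMark}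
    (h : X ++ Y = Z) (hn : inr n ∉ Z) : inr n ∉ X ∧ inr n ∉ Y := by
  rw [← h] at hn
  simpa using hn

theorem JumpForm.countP_isRight_le {g : List (α ⊕ A.JumpMark)} (h : A.JumpForm g) :
    g.countP isRight ≤ 4 := by
  have hmap : ∀ w : List α, (w.map inl : List (α ⊕ A.JumpMark)).countP isRight = 0 := by
    intro w; simp
  cases h with
  | init => simp [List.countP_cons]
  | idle q w _ =>
    simp only [List.countP_append, List.countP_cons, hmap, List.countP_nil, isRight_inr]
    simp
  | right r u v X Y _ _ h | pick r u v c X Y _ _ h | back r u v X Y _ _ h | fin w X Y _ h =>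
    have := congrArg (List.countP isRight) h
    simp only [List.countP_append, List.countP_cons, hmap, List.countP_nil, isRight_inr,
      isRight_inl, reduceIte, Bool.false_eq_true] at this ⊢
    omega
  | done w _ => simp [hmap]

/-- A head mark occurs in one kind of form only, and only once there, so it determines the form and
its own position. The lemmas for the other marks rest on the same fact. -/
theorem JumpForm.of_right_mem {g y z : List (α ⊕ A.JumpMark)} (h : A.JumpForm g)
    (hg : g = y ++ inr JumpMark.right :: z) : ∃ r u v X,
      A.RightAccepts r.1.2.2 (v ++ u) ∧ JumpsOver (A.deletable r.1.1) r.1.2.1 u ∧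
      X ++ z = u.map inl ++ r.1.2.1.map inl ++ inr hash :: (v.map inl ++ [inr JumpMark.endMark]) ∧
      y = inr (scan r (A.window u)) :: X := by
  have hm : inr JumpMark.right ∈ g := by simp [hg]
  cases h with
  | init => simp at hm
  | idle q w _ => simp at hm
  | right r u v X Y h1 h2 h =>
    obtain ⟨hX, hY⟩ := inr_notMem_of_append_eq (n := JumpMark.right) h (by simp)
    rw [← List.cons_append, List.append_cons_inj_of_notMem (by simpa using hX) hY] at hg
    obtain ⟨rfl, -, rfl⟩ := hg
    exact ⟨r, u, v, X, h1, h2, h, rfl⟩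
  | pick r u v c X Y _ _ h | back r u v X Y _ _ h | fin w X Y _ h =>
    obtain ⟨hX, hY⟩ := inr_notMem_of_append_eq (n := JumpMark.right) h (by simp)
    simp [hX, hY] at hm
  | done w _ => simp at hm

theorem JumpForm.of_pick_mem {g y z : List (α ⊕ A.JumpMark)} {c : α} (h : A.JumpForm g)
    (hg : g = y ++ inr JumpMark.pick :: inl c :: z) : ∃ r u v X,
      A.RightAccepts r.1.2.2 (v ++ c :: u) ∧ JumpsOver (A.deletable r.1.1) r.1.2.1 u ∧
      X ++ z = u.map inl ++ r.1.2.1.map inl ++ inr hash :: (v.map inl ++ [inr JumpMark.endMark]) ∧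
      y = inr (scan r (A.window u)) :: X := by
  have hm : inr JumpMark.pick ∈ g := by simp [hg]
  cases h with
  | init => simp at hm
  | idle q w _ => simp at hm
  | pick r u v c X Y h1 h2 h =>
    obtain ⟨hX, hY⟩ := inr_notMem_of_append_eq (n := JumpMark.pick) h (by simp)
    rw [← List.cons_append, List.append_cons_inj_of_notMem (by simpa using hX)
      (by simpa using hY)] at hg
    obtain ⟨rfl, -, h'⟩ := hg
    simp only [List.cons.injEq, inl.injEq] at h'
    obtain ⟨rfl, rfl⟩ := h'
    exact ⟨r, u, v, X, h1, h2, h, rfl⟩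
  | right r u v X Y _ _ h | back r u v X Y _ _ h | fin w X Y _ h =>
    obtain ⟨hX, hY⟩ := inr_notMem_of_append_eq (n := JumpMark.pick) h (by simp)
    simp [hX, hY] at hm
  | done w _ => simp at hm

theorem JumpForm.of_back_mem {g y z : List (α ⊕ A.JumpMark)} (h : A.JumpForm g)
    (hg : g = y ++ inr JumpMark.back :: z) : ∃ r u v X,
      A.RightAccepts r.1.2.2 (v ++ u) ∧ JumpsOver (A.deletable r.1.1) r.1.2.1 u ∧
      X ++ z = u.map inl ++ r.1.2.1.map inl ++ (v.map inl ++ [inr JumpMark.endMark]) ∧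
      y = inr (scan r (A.window u)) :: X := by
  have hm : inr JumpMark.back ∈ g := by simp [hg]
  cases h with
  | init => simp at hm
  | idle q w _ => simp at hm
  | back r u v X Y h1 h2 h =>
    obtain ⟨hX, hY⟩ := inr_notMem_of_append_eq (n := JumpMark.back) h (by simp)
    rw [← List.cons_append, List.append_cons_inj_of_notMem (by simpa using hX) hY] at hg
    obtain ⟨rfl, -, rfl⟩ := hg
    exact ⟨r, u, v, X, h1, h2, h, rfl⟩
  | pick r u v c X Y _ _ h | right r u v X Y _ _ h | fin w X Y _ h =>
    obtain ⟨hX, hY⟩ := inr_notMem_of_append_eq (n := JumpMark.back) h (by simp)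
    simp [hX, hY] at hm
  | done w _ => simp at hm

theorem JumpForm.of_fin_mem {g y z : List (α ⊕ A.JumpMark)} (h : A.JumpForm g)
    (hg : g = y ++ inr JumpMark.fin :: z) : ∃ w, A.RightAccepts A.start w ∧
      y ++ z = w.map inl ++ [inr JumpMark.endMark] := by
  have hm : inr JumpMark.fin ∈ g := by simp [hg]
  cases h with
  | init => simp at hm
  | idle q w _ => simp at hm
  | fin w X Y h1 h =>
    obtain ⟨hX, hY⟩ := inr_notMem_of_append_eq (n := JumpMark.fin) h (by simp)
    rw [List.append_cons_inj_of_notMem hX hY] at hg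
    obtain ⟨rfl, -, rfl⟩ := hg
    exact ⟨w, h1, h⟩
  | pick r u v c X Y _ _ h | right r u v X Y _ _ h | back r u v X Y _ _ h =>
    obtain ⟨hX, hY⟩ := inr_notMem_of_append_eq (n := JumpMark.fin) h (by simp)
    simp [hX, hY] at hm
  | done w _ => simp at hm

theorem JumpForm.of_idle_mem {g y z : List (α ⊕ A.JumpMark)} {q : Q} (h : A.JumpForm g)
    (hg : g = y ++ inr (JumpMark.idle q) :: z) : y = [] ∧ ∃ w, A.RightAccepts q w ∧
      z = w.map inl ++ [inr JumpMark.endMark] := by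
  have hm : inr (JumpMark.idle q) ∈ g := by simp [hg]
  cases h with
  | init => simp at hm
  | idle q w h1 =>
    rw [← List.nil_append (_ :: _), List.append_cons_inj_of_notMem (by simp) (by simp)] at hg
    obtain ⟨rfl, h, rfl⟩ := hg
    simp only [inr.injEq, JumpMark.idle.injEq] at h
    subst h
    exact ⟨rfl, w, h1, rfl⟩
  | pick r u v c X Y _ _ h | right r u v X Y _ _ h | back r u v X Y _ _ h | fin w X Y _ h =>
    obtain ⟨hX, hY⟩ := inr_notMem_of_append_eq (n := JumpMark.idle q) h (by simp)
    simp [hX, hY] at hm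
  | done w _ => simp at hm

theorem JumpForm.of_init_mem {g y z : List (α ⊕ A.JumpMark)} (h : A.JumpForm g)
    (hg : g = y ++ inr JumpMark.init :: z) : y = [] ∧ z = [] := by
  have hm : inr JumpMark.init ∈ g := by simp [hg]
  cases h with
  | init =>
    rw [← List.nil_append (_ :: _), List.append_cons_inj_of_notMem (by simp) (by simp)] at hg
    exact ⟨hg.1.symm, hg.2.2.symm⟩
  | idle q w _ => simp at hm
  | pick r u v c X Y _ _ h | right r u v X Y _ _ h | back r u v X Y _ _ h | fin w X Y _ h =>
    obtain ⟨hX, hY⟩ := inr_notMem_of_append_eq (n := JumpMark.init) h (by simp)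
    simp [hX, hY] at hm
  | done w _ => simp at hm

theorem RightAccepts.of_jump (r : A.rules) {u v : List α} (h : A.RightAccepts r.1.2.2 (v ++ u))
    (hu : JumpsOver (A.deletable r.1.1) r.1.2.1 u) :
    A.RightAccepts r.1.1 (u ++ r.1.2.1 ++ v) := by
  obtain ⟨f, hf, h⟩ := h
  exact ⟨f, hf, ReflTransGen.head (A.rightStep_iff.2 ⟨u, r.1.2.1, v, r.2, rfl, rfl, hu⟩) h⟩

/-- Soundness of the backward run. The forms allow a head at any position behind `scan`, so wrong
moves, such as `right` passing the end mark, are harmless dead ends. -/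
theorem JumpForm.rewriteStep {g g' : List (α ⊕ A.JumpMark)} (h : A.JumpForm g)
    (hs : RewriteStep A.JumpRule g g') : A.JumpForm g' := by
  obtain ⟨l, r, y, z, hr, hg, rfl⟩ := hs
  cases hr with
  | init f hf =>
    obtain ⟨rfl, rfl⟩ := h.of_init_mem (y := y) (z := z) (by simp [hg])
    exact JumpForm.idle f [] ⟨f, hf, .refl⟩
  | insert r =>
    obtain ⟨rfl, w, hw, rfl⟩ := h.of_idle_mem (q := r.1.2.2) (y := y) (z := z) (by simp [hg])
    have := JumpForm.right r [] w (r.1.2.1.map inl ++ [inr hash]) (w.map inl ++ [inr JumpMark.endMark])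
      (by simpa using hw) (jumpsOver_nil (A.nil_notMem_deletable _)) (by simp)
    simpa using this
  | right d =>
    obtain ⟨r, u, v, X, h1, h2, h3, rfl⟩ := h.of_right_mem (y := y) (z := d :: z) (by simp [hg])
    have := JumpForm.right r u v (X ++ [d]) z h1 h2 (by simpa using h3)
    simpa using this
  | pick c =>
    obtain ⟨r, u, v, X, h1, h2, h3, h4⟩ := h.of_right_mem (y := y ++ [inl c])
      (z := inr JumpMark.endMark :: z) (by simp [hg])
    rcases List.eq_nil_or_concat X with rfl | ⟨X, d, rfl⟩
    · simp [List.append_eq_cons_iff] at h4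
    · rw [List.concat_eq_append, ← List.cons_append] at h4
      obtain ⟨rfl, h5⟩ := List.append_inj' h4 rfl
      simp only [List.cons.injEq, and_true] at h5
      subst h5
      -- The end mark is unique, so it ends the string and the letter picked is the last letter
      -- before it. That letter belongs to `v`: were `v` empty, `hash` would stand in its place.
      have h6 := h3.symm
      rw [← List.cons_append, ← List.append_assoc, List.append_cons_inj_of_notMem (by simp)
        (by simp)] at h6
      obtain ⟨h6, -, rfl⟩ := h6
      rcases List.eq_nil_or_concat v with rfl | ⟨v, d, rfl⟩
      · rw [List.concat_eq_append] at h6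
        have := (List.append_inj' h6 rfl).2
        simp at this
      · simp only [List.concat_eq_append, List.map_append, List.map_cons, List.map_nil,
          ← List.append_assoc, ← List.cons_append] at h6
        obtain ⟨h8, h7⟩ := List.append_inj' h6 rfl
        simp only [List.cons.injEq, inl.injEq, and_true] at h7
        subst h7
        have := JumpForm.pick r u v d X [inr JumpMark.endMark] (by simpa using h1) h2
          (by rw [← h8]; simp)
        simpa using this
  | carry d c hd =>
    obtain ⟨r, u, v, X, h1, h2, h3, h4⟩ := h.of_pick_mem (y := y ++ [d]) (c := c) (z := z)
      (by simp [hg])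
    rcases List.eq_nil_or_concat X with rfl | ⟨X, e, rfl⟩
    · simp [List.append_eq_cons_iff] at h4
      exact absurd h4.2 (hd _ _)
    · rw [List.concat_eq_append, ← List.cons_append] at h4
      obtain ⟨rfl, h5⟩ := List.append_inj' h4 rfl
      simp only [List.cons.injEq, and_true] at h5
      subst h5
      have := JumpForm.pick r u v c X (d :: z) h1 h2 (by simpa using h3)
      simpa using this
  | drop r W c hW1 hW2 =>
    obtain ⟨r', u, v, X, h1, h2, h3, h4⟩ := h.of_pick_mem (y := y ++ [inr (scan r W)]) (c := c)
      (z := z) (by simp [hg])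
    rcases List.eq_nil_or_concat X with rfl | ⟨X, e, rfl⟩
    · simp [List.append_eq_cons_iff] at h4
      obtain ⟨rfl, rfl, rfl⟩ := h4
      have := JumpForm.right r (c :: u) v [inl c] z h1
        ((A.jumpsOver_cons_window r c u).2 ⟨h2, hW1, hW2⟩) (by simpa using h3)
      rw [window_cons_window]
      simpa using this
    · rw [List.concat_eq_append, ← List.cons_append] at h4
      obtain ⟨rfl, h5⟩ := List.append_inj' h4 rfl
      simp only [List.cons.injEq, and_true] at h5
      subst h5
      have := congrArg (inr (scan r W) ∈ ·) h3
      simp at this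
  | turn =>
    obtain ⟨r, u, v, X, h1, h2, h3, h4⟩ := h.of_right_mem (y := y ++ [inr hash]) (z := z)
      (by simp [hg])
    rcases List.eq_nil_or_concat X with rfl | ⟨X, e, rfl⟩
    · simp [List.append_eq_cons_iff] at h4
    · rw [List.concat_eq_append, ← List.cons_append] at h4
      obtain ⟨rfl, h5⟩ := List.append_inj' h4 rfl
      simp only [List.cons.injEq, and_true] at h5
      subst h5
      rw [List.concat_eq_append, List.append_assoc, List.singleton_append, eq_comm,
        List.append_cons_inj_of_notMem (by simp) (by simp)] at h3
      obtain ⟨rfl, -, rfl⟩ := h3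
      have := JumpForm.back r u v (u.map inl ++ r.1.2.1.map inl) (v.map inl ++ [inr JumpMark.endMark])
        h1 h2 rfl
      simpa using this
  | back d hd =>
    obtain ⟨r, u, v, X, h1, h2, h3, h4⟩ := h.of_back_mem (y := y ++ [d]) (z := z)
      (by simp [hg])
    rcases List.eq_nil_or_concat X with rfl | ⟨X, e, rfl⟩
    · simp [List.append_eq_cons_iff] at h4
      exact absurd h4.2 (hd _ _)
    · rw [List.concat_eq_append, ← List.cons_append] at h4
      obtain ⟨rfl, h5⟩ := List.append_inj' h4 rfl
      simp only [List.cons.injEq, and_true] at h5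
      subst h5
      have := JumpForm.back r u v X (d :: z) h1 h2 (by simpa using h3)
      simpa using this
  | land r W =>
    obtain ⟨r', u, v, X, h1, h2, h3, h4⟩ := h.of_back_mem (y := y ++ [inr (scan r W)]) (z := z)
      (by simp [hg])
    rcases List.eq_nil_or_concat X with rfl | ⟨X, e, rfl⟩
    · simp [List.append_eq_cons_iff] at h4
      obtain ⟨rfl, rfl, rfl⟩ := h4
      have := JumpForm.idle _ _ (h1.of_jump _ h2)
      simp only [List.nil_append] at h3
      simpa [h3] using this
    · rw [List.concat_eq_append, ← List.cons_append] at h4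
      obtain ⟨rfl, h5⟩ := List.append_inj' h4 rfl
      simp only [List.cons.injEq, and_true] at h5
      subst h5
      have := congrArg (inr (scan r W) ∈ ·) h3
      simp at this
  | fin =>
    obtain ⟨rfl, w, hw, rfl⟩ := h.of_idle_mem (q := A.start) (y := y) (z := z) (by simp [hg])
    exact JumpForm.fin w [] _ hw rfl
  | sweep d =>
    obtain ⟨w, hw, h⟩ := h.of_fin_mem (y := y) (z := d :: z) (by simp [hg])
    have := JumpForm.fin w (y ++ [d]) z hw (by simpa using h)
    simpa using this
  | endMark =>
    obtain ⟨w, hw, h⟩ := h.of_fin_mem (y := y) (z := inr JumpMark.endMark :: z) (by simp [hg])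
    rw [eq_comm, List.append_cons_inj_of_notMem (by simp) (by simp)] at h
    obtain ⟨rfl, -, rfl⟩ := h
    simpa using JumpForm.done w hw

theorem sweep_right (y D z : List (α ⊕ A.JumpMark)) :
    ReflTransGen (RewriteStep A.JumpRule) (y ++ inr JumpMark.right :: (D ++ z))
      (y ++ (D ++ inr JumpMark.right :: z)) := by
  induction D generalizing y with
  | nil => exact .refl
  | cons d D ih =>
    have := ih (y ++ [d])
    refine ReflTransGen.head ⟨_, _, y, D ++ z, JumpRule.right d, by simp, rfl⟩ ?_
    simpa using this

theorem sweep_fin (D z : List (α ⊕ A.JumpMark)) (y : List (α ⊕ A.JumpMark)) :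
    ReflTransGen (RewriteStep A.JumpRule) (y ++ inr JumpMark.fin :: (D ++ z))
      (y ++ (D ++ inr JumpMark.fin :: z)) := by
  induction D generalizing y with
  | nil => exact .refl
  | cons d D ih =>
    have := ih (y ++ [d])
    refine ReflTransGen.head ⟨_, _, y, D ++ z, JumpRule.sweep d, by simp, rfl⟩ ?_
    simpa using this

theorem sweep_pick (y D z : List (α ⊕ A.JumpMark)) (c : α)
    (hD : ∀ d ∈ D, ∀ r W, d ≠ inr (scan r W)) :
    ReflTransGen (RewriteStep A.JumpRule) (y ++ (D ++ inr JumpMark.pick :: inl c :: z))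
      (y ++ inr JumpMark.pick :: inl c :: (D ++ z)) := by
  induction D using List.reverseRecOn generalizing z with
  | nil => exact .refl
  | append_singleton D d ih =>
    refine ReflTransGen.head ⟨_, _, y ++ D, z, JumpRule.carry d c (hD d (by simp)), by simp,
      rfl⟩ ?_
    simpa using ih (d :: z) fun e he => hD e (by simp [he])

theorem sweep_back (y D z : List (α ⊕ A.JumpMark))
    (hD : ∀ d ∈ D, ∀ r W, d ≠ inr (scan r W)) :
    ReflTransGen (RewriteStep A.JumpRule) (y ++ (D ++ inr JumpMark.back :: z))
      (y ++ inr JumpMark.back :: (D ++ z)) := by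
  induction D using List.reverseRecOn generalizing z with
  | nil => exact .refl
  | append_singleton D d ih =>
    refine ReflTransGen.head ⟨_, _, y ++ D, z, JumpRule.back d (hD d (by simp)), by simp,
      rfl⟩ ?_
    simpa using ih (d :: z) fun e he => hD e (by simp [he])

/-- One round trip for each letter of `u₁`, last letter first: `right` runs to the end, `pick`
brings the letter to the front, and `drop` tests it against the window. -/
theorem reflTransGen_scan (r : A.rules) (u₁ u₂ v : List α)
    (hu : JumpsOver (A.deletable r.1.1) r.1.2.1 (u₁ ++ u₂)) :
    ReflTransGen (RewriteStep A.JumpRule)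
      (inr (scan r (A.window u₂)) :: (u₂.map inl ++ r.1.2.1.map inl ++ inr hash ::
        inr JumpMark.right :: ((v ++ u₁).map inl ++ [inr JumpMark.endMark])))
      (inr (scan r (A.window (u₁ ++ u₂))) :: ((u₁ ++ u₂).map inl ++ r.1.2.1.map inl ++ inr hash ::
        inr JumpMark.right :: (v.map inl ++ [inr JumpMark.endMark]))) := by
  induction u₁ using List.reverseRecOn generalizing u₂ with
  | nil => simpa using ReflTransGen.refl
  | append_singleton u₁ c ih =>
    -- Admissibility passes to suffixes: the letters of `u₁` are removed from the front.
    have hc : JumpsOver (A.deletable r.1.1) r.1.2.1 (c :: u₂) := by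
      clear ih
      induction u₁ with
      | nil => exact hu
      | cons d u₁ ih => exact ih ((A.jumpsOver_cons_window r d _).1 hu).1
    obtain ⟨-, hW1, hW2⟩ := (A.jumpsOver_cons_window r c u₂).1 hc
    have h1 := sweep_right (A := A) (inr (scan r (A.window u₂)) :: (u₂.map inl ++
      r.1.2.1.map inl ++ [inr hash])) ((v ++ u₁ ++ [c]).map inl) [inr JumpMark.endMark]
    have h2 : RewriteStep A.JumpRule _ _ := ⟨_, _, inr (scan r (A.window u₂)) :: (u₂.map inl ++
      r.1.2.1.map inl ++ [inr hash] ++ (v ++ u₁).map inl), [], JumpRule.pick c, rfl, rfl⟩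
    have h3 := sweep_pick (A := A) [inr (scan r (A.window u₂))] (u₂.map inl ++
      r.1.2.1.map inl ++ [inr hash] ++ (v ++ u₁).map inl) [inr JumpMark.endMark] c (by
        intro d hd
        simp only [List.mem_append, List.mem_map, List.mem_singleton] at hd
        rcases hd with ((⟨_, _, rfl⟩ | ⟨_, _, rfl⟩) | rfl) | ⟨_, _, rfl⟩ <;> simp)
    have h4 : RewriteStep A.JumpRule _ _ := ⟨_, _, [], u₂.map inl ++
      r.1.2.1.map inl ++ [inr hash] ++ (v ++ u₁).map inl ++ [inr JumpMark.endMark],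
      JumpRule.drop r _ c hW1 hW2, rfl, rfl⟩
    rw [window_cons_window] at h4
    have h5 := sweep_right (A := A) [inr (scan r (A.window (c :: u₂))), inl c] (u₂.map inl ++
      r.1.2.1.map inl ++ [inr hash]) ((v ++ u₁).map inl ++ [inr JumpMark.endMark])
    have h6 := ih (c :: u₂) (by simpa using hu)
    simp only [List.append_assoc, List.cons_append, List.nil_append, List.map_append, List.map_cons,
      List.map_nil, List.append_nil] at h1 h2 h3 h4 h5 h6 ⊢
    exact h1.trans (.head h2 (h3.trans (.head h4 (h5.trans h6))))

/-- Induction from the accepting end of the run. Each automaton step is undone by `insert`, the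
transport of `u`, `turn`, the way back and `land`. -/
theorem reflTransGen_idle {q : Q} {w : List α} (h : A.RightAccepts q w) :
    ReflTransGen (RewriteStep A.JumpRule) [inr JumpMark.init]
      (inr (idle q) :: (w.map inl ++ [inr JumpMark.endMark])) := by
  obtain ⟨f, hf, h⟩ := h
  generalize hc : (q, w) = c at h
  induction h using ReflTransGen.head_induction_on generalizing q w with
  | refl =>
    simp only [Prod.mk.injEq] at hc
    obtain ⟨rfl, rfl⟩ := hc
    exact .single (.of_rule (JumpRule.init q hf))
  | head hs _ ih =>
    subst hc
    rename_i d _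
    obtain ⟨u, x, v, hr, rfl, hd, hu⟩ := A.rightStep_iff.1 hs
    obtain ⟨q', w'⟩ := d
    simp only at hr hd hu
    subst hd
    have h0 := ih rfl
    have h1 : RewriteStep A.JumpRule _ _ := ⟨_, _, [], (v ++ u).map inl ++ [inr JumpMark.endMark],
      JumpRule.insert ⟨_, hr⟩, rfl, rfl⟩
    have h2 := reflTransGen_scan ⟨_, hr⟩ u [] v (by simpa using hu)
    have h3 : RewriteStep A.JumpRule _ _ := ⟨_, _, inr (scan ⟨_, hr⟩ (A.window u)) ::
      (u.map inl ++ x.map inl), v.map inl ++ [inr JumpMark.endMark], JumpRule.turn, rfl, rfl⟩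
    have h4 := sweep_back (A := A) [inr (scan ⟨_, hr⟩ (A.window u))] (u.map inl ++ x.map inl)
      (v.map inl ++ [inr JumpMark.endMark]) (by
        intro d hd
        simp only [List.mem_append, List.mem_map] at hd
        rcases hd with ⟨_, _, rfl⟩ | ⟨_, _, rfl⟩ <;> simp)
    have h5 : RewriteStep A.JumpRule _ _ := ⟨_, _, [], u.map inl ++ x.map inl ++
      (v.map inl ++ [inr JumpMark.endMark]), JumpRule.land ⟨_, hr⟩ (A.window u), rfl, rfl⟩
    simp only [List.append_assoc, List.cons_append, List.nil_append, List.map_append,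
      List.map_nil, List.append_nil] at h0 h1 h2 h3 h4 h5 ⊢
    exact h0.trans (.head h1 (h2.trans (.head h3 (h4.tail h5))))

theorem reflTransGen_jumpRule_iff {w : List α} :
    ReflTransGen (RewriteStep A.JumpRule) [inr JumpMark.init] (w.map inl) ↔
      w ∈ A.rightLanguage := by
  constructor
  · intro h
    have key : ∀ g, ReflTransGen (RewriteStep A.JumpRule) [inr JumpMark.init] g →
        A.JumpForm g := by
      intro g hg
      induction hg with
      | refl => exact .init
      | tail _ hs ih => exact ih.rewriteStep hs
    have h := key _ h
    generalize hg : w.map inl = g at h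
    cases h with
    | done w' h =>
      rw [List.map_inj_right fun _ _ => inl.inj] at hg
      exact hg ▸ h
    | init => have := congrArg (inr JumpMark.init ∈ ·) hg; simp at this
    | idle q w' _ => have := congrArg (inr (idle q) ∈ ·) hg; simp at this
    | right r u v X Y _ _ _ => have := congrArg (inr JumpMark.right ∈ ·) hg; simp at this
    | pick r u v c X Y _ _ _ => have := congrArg (inr JumpMark.pick ∈ ·) hg; simp at this
    | back r u v X Y _ _ _ => have := congrArg (inr JumpMark.back ∈ ·) hg; simp at this
    | fin w X Y _ _ => have := congrArg (inr JumpMark.fin ∈ ·) hg; simp at this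
  · intro h
    have h1 := reflTransGen_idle (A := A) (q := A.start) h
    have h2 : RewriteStep A.JumpRule _ _ := ⟨_, _, [], w.map inl ++ [inr JumpMark.endMark],
      JumpRule.fin, rfl, rfl⟩
    have h3 := sweep_fin (A := A) (w.map inl) [inr JumpMark.endMark] []
    have h4 : RewriteStep A.JumpRule _ _ := ⟨_, _, w.map inl, [], JumpRule.endMark, rfl, rfl⟩
    simp only [List.cons_append, List.nil_append, List.append_nil] at h1 h2 h3 h4
    exact h1.trans (.head h2 (h3.tail h4))

theorem rightLanguage_mem_CS [Finite α] [Finite Q] (A : GCOWJFA α Q) : A.rightLanguage ∈ CS α := by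
  have : A.rightLanguage =
      ({w | ReflTransGen (RewriteStep A.JumpRule) [inr JumpMark.init] (w.map inl)} :
        Language α) := by
    ext w
    exact reflTransGen_jumpRule_iff.symm
  rw [this]
  have hmap : ∀ w : List α, (w.map inl : List (α ⊕ A.JumpMark)).countP isLeft = w.length := by
    intro w; simp [List.countP_map, Function.comp_def]
  -- The longest side belongs to `insert`: a deleted word and three marks. The four marks are
  -- `scan`, `hash`, a head and the end mark.
  refine mem_CS_of_rewriting A.JumpRule _ (A.ruleBound + 3) 4 (by simp) ?_ ?_ ?_ ?_
  · intro l r h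
    cases h with
    | insert r =>
      have := A.length_le_ruleBound r.2
      simp
      omega
    | _ => simp
  · intro l r h
    cases h <;> simp only [List.countP_append, List.countP_cons, hmap, List.countP_nil,
      isLeft_inr, isLeft_inl, reduceIte, Bool.false_eq_true] <;> omega
  · intro l r h
    cases h with
    | init => exact ⟨_, .head _⟩
    | insert => exact ⟨_, .head _⟩
    | right => exact ⟨_, .head _⟩
    | pick => exact ⟨_, .tail _ (.head _)⟩
    | carry => exact ⟨_, .tail _ (.head _)⟩
    | drop => exact ⟨_, .head _⟩
    | turn => exact ⟨_, .head _⟩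
    | back => exact ⟨_, .tail _ (.head _)⟩
    | land => exact ⟨_, .head _⟩
    | fin => exact ⟨_, .head _⟩
    | sweep => exact ⟨_, .head _⟩
    | endMark => exact ⟨_, .head _⟩
  · intro g hg
    refine JumpForm.countP_isRight_le (A := A) ?_
    induction hg with
    | refl => exact .init
    | tail _ hs ih => exact ih.rewriteStep hs

end GCOWJFA

/-! ### Reversal of context-sensitive languages -/

namespace ContextSensitiveGrammar

variable {α : Type} (g : ContextSensitiveGrammar α)

open Classical in
/-- The grammar with both sides of all productions reversed. -/
noncomputable def reverse : ContextSensitiveGrammar α where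
  NT := g.NT
  initial := g.initial
  rules := g.rules.image fun r => (r.1.reverse, r.2.reverse)
  exists_nonterminal := fun r hr => by
    obtain ⟨s, hs, rfl⟩ := Finset.mem_image.1 hr
    simpa using g.exists_nonterminal s hs
  length_le := fun r hr => by
    obtain ⟨s, hs, rfl⟩ := Finset.mem_image.1 hr
    simpa using g.length_le s hs

variable {g}

theorem mem_rules_reverse {l r : List (Symbol α g.NT)} :
    (l, r) ∈ g.reverse.rules ↔ (l.reverse, r.reverse) ∈ g.rules := by
  classical
  refine (Finset.mem_image (b := (l, r))).trans ⟨?_, fun h => ⟨_, h, by simp⟩⟩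
  rintro ⟨⟨l', r'⟩, hs, h⟩
  simp only [Prod.mk.injEq] at h
  obtain ⟨rfl, rfl⟩ := h
  simpa using hs

theorem reverse_append_append {β : Type} (x y z : List β) :
    (x ++ y ++ z).reverse = z.reverse ++ y.reverse ++ x.reverse := by simp

theorem Produces.reverse {s t : List (Symbol α g.NT)} (h : g.Produces s t) :
    g.reverse.Produces s.reverse t.reverse := by
  obtain ⟨⟨l, r⟩, hr, y, z, rfl, rfl⟩ := h
  exact ⟨(l.reverse, r.reverse), mem_rules_reverse.2 (by simpa using hr), z.reverse, y.reverse,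
    reverse_append_append .., reverse_append_append ..⟩

theorem Produces.of_reverse {s t : List (Symbol α g.NT)} (h : g.reverse.Produces s t) :
    g.Produces s.reverse t.reverse := by
  obtain ⟨⟨l, r⟩, hr, y, z, rfl, rfl⟩ := h
  exact ⟨(l.reverse, r.reverse), mem_rules_reverse.1 hr, z.reverse, y.reverse,
    reverse_append_append .., reverse_append_append ..⟩

theorem language_reverse : g.reverse.language = g.language.reverse := by
  ext w
  rw [Language.mem_reverse]
  constructor
  · intro h
    have h1 : ReflTransGen g.reverse.Produces [Symbol.nonterminal g.initial]
      (w.map Symbol.terminal) := h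
    have h2 : ReflTransGen g.Produces [Symbol.nonterminal g.initial]
        (w.map Symbol.terminal).reverse :=
      h1.lift List.reverse fun s t (h : g.reverse.Produces s t) => h.of_reverse
    rw [← List.map_reverse] at h2
    exact h2
  · intro h
    have h1 : ReflTransGen g.Produces [Symbol.nonterminal g.initial]
      (w.reverse.map Symbol.terminal) := h
    have h2 : ReflTransGen g.reverse.Produces [Symbol.nonterminal g.reverse.initial]
        (w.reverse.map Symbol.terminal).reverse :=
      h1.lift List.reverse fun s t (h : g.Produces s t) => h.reverse
    rw [← List.map_reverse, List.reverse_reverse] at h2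
    exact h2

end ContextSensitiveGrammar

theorem reverse_mem_CS {α : Type} {L : Language α} (h : L ∈ CS α) : L.reverse ∈ CS α := by
  obtain ⟨g, rfl | rfl⟩ := h
  · exact ⟨g.reverse, .inl ContextSensitiveGrammar.language_reverse.symm⟩
  · refine ⟨g.reverse, .inr ?_⟩
    rw [ContextSensitiveGrammar.language_reverse]
    ext w
    simp [Language.mem_reverse, Language.mem_add, Language.mem_one]

/-! ### Left automata as reversed right automata -/

namespace GCOWJFA

variable {α Q : Type}

open Classical in
/-- The automaton with the deleted words reversed. -/
noncomputable def reverse (A : GCOWJFA α Q) : GCOWJFA α Q where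
  start := A.start
  final := A.final
  rules := A.rules.image fun r => (r.1, r.2.1.reverse, r.2.2)
  ne_nil := fun p w q h => by
    obtain ⟨⟨p', w', q'⟩, hs, h⟩ := Finset.mem_image.1 h
    simp only [Prod.mk.injEq] at h
    obtain ⟨rfl, rfl, rfl⟩ := h
    simpa using A.ne_nil _ _ _ hs
  deterministic := fun p w q q' h h' => by
    obtain ⟨⟨p₁, w₁, q₁⟩, hs, h⟩ := Finset.mem_image.1 h
    obtain ⟨⟨p₂, w₂, q₂⟩, hs', h'⟩ := Finset.mem_image.1 h'
    simp only [Prod.mk.injEq] at h h'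
    obtain ⟨rfl, rfl, rfl⟩ := h
    obtain ⟨rfl, h2, rfl⟩ := h'
    rw [List.reverse_inj] at h2
    subst h2
    exact A.deterministic _ _ _ _ hs hs'

variable {A : GCOWJFA α Q}

theorem mem_rules_reverse {p q : Q} {w : List α} :
    (p, w, q) ∈ A.reverse.rules ↔ (p, w.reverse, q) ∈ A.rules := by
  simp only [reverse, Finset.mem_image]
  constructor
  · rintro ⟨⟨p', w', q'⟩, hs, h⟩
    simp only [Prod.mk.injEq] at h
    obtain ⟨rfl, rfl, rfl⟩ := h
    simpa using hs
  · intro h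
    exact ⟨_, h, by simp⟩

theorem leftStep_iff_rightStep_reverse {p q : Q} {w w' : List α} :
    A.LeftStep (p, w) (q, w') ↔ A.reverse.RightStep (p, w.reverse) (q, w'.reverse) := by
  constructor
  · rintro ⟨u, x, v, hr, hw, hw', h1, h2⟩
    simp only at hr hw hw' h1
    subst hw hw'
    refine ⟨u.reverse, x.reverse, v.reverse, mem_rules_reverse.2 (by simpa using hr), by simp,
      by simp, ?_, ?_⟩
    · rintro y ⟨q', hy⟩ hinf
      exact h1 y.reverse ⟨q', mem_rules_reverse.1 hy⟩ (by
        rwa [← List.reverse_infix, List.reverse_reverse])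
    · intro u₁ u₂ x₁ x₂ hu hx hu₂ hx₁ hov
      refine h2 u₂.reverse u₁.reverse x₂.reverse x₁.reverse ?_ ?_ (by simpa using hu₂)
        (by simpa using hx₁) ?_
      · rw [← List.reverse_append, ← hu, List.reverse_reverse]
      · rw [← List.reverse_append, ← hx, List.reverse_reverse]
      · rw [← List.reverse_append, hov, List.reverse_reverse]
  · rintro ⟨u, x, v, hr, hw, hw', h1, h2⟩
    simp only at hr hw hw' h1
    rw [List.reverse_eq_iff] at hw hw'
    subst hw hw'
    refine ⟨u.reverse, x.reverse, v.reverse, mem_rules_reverse.1 hr, by simp, by simp, ?_, ?_⟩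
    · rintro y ⟨q', hy⟩ hinf
      exact h1 y.reverse ⟨q', mem_rules_reverse.2 (by simpa using hy)⟩ (by
        rwa [← List.reverse_infix, List.reverse_reverse])
    · intro u₁ u₂ x₁ x₂ hu hx hu₂ hx₁ hov
      refine h2 u₂.reverse u₁.reverse x₂.reverse x₁.reverse ?_ ?_ (by simpa using hu₂)
        (by simpa using hx₁) ?_
      · rw [← List.reverse_append, ← hu, List.reverse_reverse]
      · rw [← List.reverse_append, ← hx, List.reverse_reverse]
      · rw [← List.reverse_append, hov, List.reverse_reverse]

theorem leftLanguage_eq : A.leftLanguage = A.reverse.rightLanguage.reverse := by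
  ext w
  rw [Language.mem_reverse]
  constructor
  · rintro ⟨f, hf, h⟩
    exact ⟨f, hf, h.lift (fun c : Q × List α => (c.1, c.2.reverse))
      fun _ _ h => leftStep_iff_rightStep_reverse.1 h⟩
  · rintro ⟨f, hf, h⟩
    have := h.lift (p := A.LeftStep) (fun c : Q × List α => (c.1, c.2.reverse))
      fun _ _ h => leftStep_iff_rightStep_reverse.2 (by simpa using h)
    refine ⟨f, hf, ?_⟩
    simp only [Function.onFun, List.reverse_reverse, List.reverse_nil] at this
    exact this

end GCOWJFA

theorem GRCOWJ_subset_CS {α : Type} [Finite α] : GRCOWJ α ⊆ CS α := by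
  rintro _ ⟨Q, _, A, rfl⟩
  exact A.rightLanguage_mem_CS

theorem reverse_mem_GRCOWJ {α : Type} {L : Language α} (h : L ∈ GLCOWJ α) :
    L.reverse ∈ GRCOWJ α := by
  obtain ⟨Q, hQ, A, rfl⟩ := h
  exact ⟨Q, hQ, A.reverse, by rw [GCOWJFA.leftLanguage_eq, Language.reverse_reverse]⟩

theorem GLCOWJ_subset_CS {α : Type} [Finite α] : GLCOWJ α ⊆ CS α := fun L h => by
  simpa using reverse_mem_CS (GRCOWJ_subset_CS (reverse_mem_GRCOWJ h))

/-! ### The Dyck language is context-sensitive -/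

section Dyck

variable {α : Type} {a b : α}

/-- The letter for a step of a Dyck word. -/
def dyckLetter (a b : α) : DyckStep → α
  | .U => a
  | .D => b

theorem mem_dyckLanguage {w : List α} :
    w ∈ dyckLanguage a b ↔ ∃ d : DyckWord, w = d.toList.map (dyckLetter a b) := by
  have : (fun s => match s with
    | DyckStep.U => a
    | DyckStep.D => b) = dyckLetter a b := by
    funext s
    cases s <;> rfl
  rw [← this]
  rfl

theorem nil_mem_dyckLanguage : [] ∈ dyckLanguage a b := mem_dyckLanguage.2 ⟨0, rfl⟩

theorem append_mem_dyckLanguage {w w' : List α} (h : w ∈ dyckLanguage a b)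
    (h' : w' ∈ dyckLanguage a b) : w ++ w' ∈ dyckLanguage a b := by
  obtain ⟨d, rfl⟩ := mem_dyckLanguage.1 h
  obtain ⟨d', rfl⟩ := mem_dyckLanguage.1 h'
  exact mem_dyckLanguage.2 ⟨d + d', (List.map_append ..).symm⟩

theorem nest_mem_dyckLanguage {w : List α} (h : w ∈ dyckLanguage a b) :
    a :: (w ++ [b]) ∈ dyckLanguage a b := by
  obtain ⟨d, rfl⟩ := mem_dyckLanguage.1 h
  exact mem_dyckLanguage.2 ⟨d.nest, by simp [DyckWord.nest, dyckLetter]⟩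

theorem nest_append_mem_dyckLanguage {w w' : List α} (h : w ∈ dyckLanguage a b)
    (h' : w' ∈ dyckLanguage a b) : a :: (w ++ b :: w') ∈ dyckLanguage a b := by
  simpa using append_mem_dyckLanguage (nest_mem_dyckLanguage h) h'

/-- This is the decomposition of a Dyck word at its first return to height zero. -/
theorem dyckLanguage_induction {P : (w : List α) → w ∈ dyckLanguage a b → Prop}
    (nil : P [] nil_mem_dyckLanguage)
    (nest : ∀ w w' (h : w ∈ dyckLanguage a b) (h' : w' ∈ dyckLanguage a b), P w h → P w' h' →
      P (a :: (w ++ b :: w')) (nest_append_mem_dyckLanguage h h'))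
    {w : List α} (h : w ∈ dyckLanguage a b) : P w h := by
  obtain ⟨d, rfl⟩ := mem_dyckLanguage.1 h
  induction hn : d.semilength using Nat.strong_induction_on generalizing d with
  | _ n ih =>
    by_cases hd : d = 0
    · subst hd
      exact nil
    · have h1 := ih _ (hn ▸ DyckWord.semilength_insidePart_lt hd) d.insidePart
        (mem_dyckLanguage.2 ⟨_, rfl⟩) rfl
      have h2 := ih _ (hn ▸ DyckWord.semilength_outsidePart_lt hd) d.outsidePart
        (mem_dyckLanguage.2 ⟨_, rfl⟩) rfl
      have := nest _ _ _ _ h1 h2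
      have h3 : d.toList = (d.insidePart.nest + d.outsidePart).toList := by
        rw [DyckWord.nest_insidePart_add_outsidePart hd]
      have h4 : (d.insidePart.nest + d.outsidePart).toList =
        [DyckStep.U] ++ d.insidePart.toList ++ [DyckStep.D] ++ d.outsidePart.toList := rfl
      rw [h4] at h3
      simpa [h3, dyckLetter] using this

/-- The insertion point lies before the first letter, in the inner part or in the outer part of the
first-return decomposition. This makes `DyckRule.grow` sound. -/
theorem insert_mem_dyckLanguage {w : List α} (h : w ∈ dyckLanguage a b) :
    ∀ w₁ w₂, w = w₁ ++ w₂ → w₁ ++ a :: b :: w₂ ∈ dyckLanguage a b := by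
  induction h using dyckLanguage_induction with
  | nil =>
    intro w₁ w₂ h
    obtain ⟨rfl, rfl⟩ := List.append_eq_nil_iff.1 h.symm
    exact nest_mem_dyckLanguage nil_mem_dyckLanguage
  | nest w w' hw hw' ih ih' =>
    rintro (_ | ⟨c, w₁⟩) w₂ h
    · rw [List.nil_append] at h
      subst h
      exact nest_append_mem_dyckLanguage nil_mem_dyckLanguage (nest_append_mem_dyckLanguage hw hw')
    · simp only [List.cons_append, List.cons.injEq] at h
      obtain ⟨rfl, h⟩ := h
      rcases List.append_eq_append_iff.1 h with ⟨t, rfl, ht⟩ | ⟨t, rfl, rfl⟩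
      · rcases t with _ | ⟨d, t⟩
        · change b :: w' = w₂ at ht
          subst ht
          simpa using nest_append_mem_dyckLanguage (ih w [] (by simp)) hw'
        · obtain ⟨rfl, rfl⟩ := List.cons.inj ht
          simpa using nest_append_mem_dyckLanguage hw (ih' t w₂ rfl)
      · simpa using nest_append_mem_dyckLanguage (ih w₁ t rfl) hw'

theorem reverse_mem_dyckLanguage {w : List α} (h : w ∈ dyckLanguage a b) :
    w.reverse ∈ dyckLanguage b a := by
  induction h using dyckLanguage_induction with
  | nil => exact nil_mem_dyckLanguage
  | nest w w' _ _ h h' => simpa using append_mem_dyckLanguage h' (nest_mem_dyckLanguage h)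

theorem dyckLanguage_reverse (a b : α) : (dyckLanguage a b).reverse = dyckLanguage b a := by
  ext w
  rw [Language.mem_reverse]
  constructor
  · intro h
    simpa using reverse_mem_dyckLanguage h
  · exact reverse_mem_dyckLanguage

open Sum

/-- A rewriting system for the Dyck language: a mark moves to the right, inserts `a b` anywhere on
its way, and finally disappears. -/
inductive DyckRule (a b : α) : List (α ⊕ Unit) → List (α ⊕ Unit) → Prop
  | grow : DyckRule a b [inr ()] [inr (), inl a, inl b]
  | move (d : α ⊕ Unit) : DyckRule a b [inr (), d] [d, inr ()]
  | vanish : DyckRule a b [inr ()] []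

/-- The strings that occur in the rewriting system `DyckRule`. -/
inductive DyckForm (a b : α) : List (α ⊕ Unit) → Prop
  | mark (X Y : List α) : X ++ Y ∈ dyckLanguage a b →
      DyckForm a b (X.map inl ++ inr () :: Y.map inl)
  | done (w : List α) : w ∈ dyckLanguage a b → DyckForm a b (w.map inl)

theorem DyckForm.of_mark_mem {y z : List (α ⊕ Unit)} (h : DyckForm a b (y ++ inr () :: z)) :
    ∃ X Y : List α, y = X.map inl ∧ z = Y.map inl ∧ X ++ Y ∈ dyckLanguage a b := by
  generalize hg : y ++ inr () :: z = g at h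
  cases h with
  | mark X Y h =>
    rw [eq_comm, List.append_cons_inj_of_notMem (by simp) (by simp)] at hg
    exact ⟨X, Y, hg.1.symm, hg.2.2.symm, h⟩
  | done w h =>
    have := congrArg (inr () ∈ ·) hg
    simp at this

theorem DyckForm.rewriteStep {g g' : List (α ⊕ Unit)} (h : DyckForm a b g)
    (hs : RewriteStep (DyckRule a b) g g') : DyckForm a b g' := by
  obtain ⟨l, r, y, z, hr, rfl, rfl⟩ := hs
  cases hr with
  | grow =>
    obtain ⟨X, Y, rfl, rfl, h'⟩ := DyckForm.of_mark_mem (y := y) (z := z) (by simpa using h)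
    simpa using DyckForm.mark X (a :: b :: Y) (insert_mem_dyckLanguage h' X Y rfl)
  | move d =>
    obtain ⟨X, Y, rfl, hz, h'⟩ := DyckForm.of_mark_mem (y := y) (z := d :: z) (by simpa using h)
    rcases Y with _ | ⟨c, Y⟩
    · simp at hz
    · simp only [List.map_cons, List.cons.injEq] at hz
      obtain ⟨rfl, rfl⟩ := hz
      simpa using DyckForm.mark (X ++ [c]) Y (by simpa using h')
  | vanish =>
    obtain ⟨X, Y, rfl, rfl, h'⟩ := DyckForm.of_mark_mem (y := y) (z := z) (by simpa using h)
    simpa using DyckForm.done (X ++ Y) h'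

theorem DyckForm.of_reflTransGen {g : List (α ⊕ Unit)}
    (h : ReflTransGen (RewriteStep (DyckRule a b)) [inr ()] g) : DyckForm a b g := by
  induction h with
  | refl => exact DyckForm.mark [] [] nil_mem_dyckLanguage
  | tail _ hs ih => exact ih.rewriteStep hs

/-- The mark leaves `w` behind: for `a w b w'` it grows `a b`, passes `a`, produces `w`, passes `b`
and produces `w'`. The context `y`, `z` is arbitrary for the sake of this induction. -/
theorem reflTransGen_dyckRule {w : List α} (h : w ∈ dyckLanguage a b) :
    ∀ y z : List (α ⊕ Unit), ReflTransGen (RewriteStep (DyckRule a b)) (y ++ inr () :: z)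
      (y ++ (w.map inl ++ inr () :: z)) := by
  induction h using dyckLanguage_induction with
  | nil => exact fun y z => .refl
  | nest w w' _ _ ih ih' =>
    intro y z
    have h1 : RewriteStep (DyckRule a b) _ _ := ⟨_, _, y, z, .grow, rfl, rfl⟩
    have h2 : RewriteStep (DyckRule a b) _ _ := ⟨_, _, y, inl b :: z, .move (inl a), rfl, rfl⟩
    have h3 := ih (y ++ [inl a]) (inl b :: z)
    have h4 : RewriteStep (DyckRule a b) _ _ :=
      ⟨_, _, y ++ inl a :: w.map inl, z, .move (inl b), rfl, rfl⟩
    have h5 := ih' (y ++ inl a :: (w.map inl ++ [inl b])) z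
    simp only [List.append_assoc, List.cons_append, List.nil_append, List.map_append,
      List.map_cons] at h1 h2 h3 h4 h5 ⊢
    exact .head h1 (.head h2 (h3.trans (.head h4 h5)))

theorem dyckLanguage_mem_CS [Finite α] (a b : α) : dyckLanguage a b ∈ CS α := by
  have : dyckLanguage a b =
      ({w | ReflTransGen (RewriteStep (DyckRule a b)) [inr ()] (w.map inl)} : Language α) := by
    ext w
    constructor
    · intro h
      have h1 := reflTransGen_dyckRule h [] []
      have h2 : RewriteStep (DyckRule a b) _ _ := ⟨_, _, w.map inl, [], .vanish, rfl, rfl⟩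
      simp only [List.nil_append, List.append_nil] at h1 h2
      exact h1.tail h2
    · intro h
      have h := DyckForm.of_reflTransGen h
      generalize hg : w.map inl = g at h
      cases h with
      | mark X Y _ => have := congrArg (inr () ∈ ·) hg; simp at this
      | done w' h =>
        rw [List.map_inj_right fun _ _ => inl.inj] at hg
        exact hg ▸ h
  rw [this]
  refine mem_CS_of_rewriting (DyckRule a b) [inr ()] 3 1 (by simp) ?_ ?_ ?_ ?_
  · rintro l r (_ | d | _) <;> simp
  · rintro l r (_ | d | _) <;> simp [List.countP_cons]
  · rintro l r (_ | d | _) <;> exact ⟨(), .head _⟩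
  · intro g hg
    have hmap : ∀ w : List α, (w.map inl : List (α ⊕ Unit)).countP isRight = 0 := by
      intro w; simp
    cases DyckForm.of_reflTransGen hg with
    | mark X Y _ =>
      simp only [List.countP_append, List.countP_cons, hmap, isRight_inr]
      simp
    | done w _ => simp only [hmap]; omega

end Dyck

/-! ### Leftmost occurrences and words with two blocks -/

section Words

variable {α : Type}

theorem eq_replicate_append_of_infix {l l' : α} {p q : ℕ} {w : List α}
    (h : w <:+: List.replicate p l ++ List.replicate q l') :
    ∃ s t, w = List.replicate s l ++ List.replicate t l' ∧ s ≤ p ∧ t ≤ q := by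
  rcases List.infix_append_iff.1 h with h | h | ⟨y, z, rfl, hy, hz⟩
  · obtain ⟨h1, h2⟩ := List.infix_replicate_iff.1 h
    exact ⟨_, 0, by simpa using h2, h1, by simp⟩
  · obtain ⟨h1, h2⟩ := List.infix_replicate_iff.1 h
    exact ⟨0, _, by simpa using h2, by simp, h1⟩
  · obtain ⟨h1, h2⟩ := List.suffix_replicate_iff.1 hy
    obtain ⟨h3, h4⟩ := List.prefix_replicate_iff.1 hz
    exact ⟨_, _, by rw [← h2, ← h4], h1, h3⟩

theorem replicate_append_infix {l l' : α} {s t p q : ℕ} (hs : s ≤ p) (ht : t ≤ q) :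
    List.replicate s l ++ List.replicate t l' <:+: List.replicate p l ++ List.replicate q l' := by
  obtain ⟨p, rfl⟩ := Nat.exists_eq_add_of_le' hs
  obtain ⟨q, rfl⟩ := Nat.exists_eq_add_of_le ht
  exact ⟨List.replicate p l, List.replicate q l', by
    rw [List.replicate_add, List.replicate_add]
    simp only [List.append_assoc]⟩

theorem JumpsOver.not_prefix {D : Set (List α)} {x u : List α} (h : JumpsOver D x u) (hx : x ∈ D)
    {u₁ u₂ : List α} (hu : u = u₁ ++ u₂) (hne : u₂ ≠ []) : ¬ x <+: u₂ ++ x := by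
  induction u₁ generalizing u with
  | nil =>
    obtain ⟨c, t, rfl⟩ := List.exists_cons_of_ne_nil hne
    simp only [List.nil_append] at hu
    subst hu
    exact ((jumpsOver_cons hx c t).1 h).2.2
  | cons c u₁ ih =>
    subst hu
    exact ih ((jumpsOver_cons hx c _).1 h).1 rfl

theorem JumpsOver.singleton {D : Set (List α)} {x u : List α} (h : JumpsOver D x u) (hx : x ∈ D) :
    JumpsOver {x} x u :=
  ⟨fun w hw => by
    rw [Set.mem_singleton_iff.1 hw]
    exact h.1 x hx, h.2⟩

/-- An occurrence of `x` that starts earlier, inside `u`, would make `x` a prefix of `t ++ x` for a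
nonempty suffix `t` of `u`. Deletion thus takes place at the leftmost occurrence. -/
theorem JumpsOver.length_le {x u v u' v' : List α} (h : JumpsOver {x} x u)
    (he : u ++ x ++ v = u' ++ x ++ v') : u.length ≤ u'.length := by
  by_contra hlt
  push Not at hlt
  rw [List.append_assoc, List.append_assoc, List.append_eq_append_iff] at he
  rcases he with ⟨t, rfl, -⟩ | ⟨t, rfl, he⟩
  · simp at hlt
  · have ht : t ≠ [] := by
      rintro rfl
      simp at hlt
    refine h.not_prefix rfl rfl ht ?_
    refine List.prefix_of_prefix_length_le (l₃ := t ++ (x ++ v)) ?_ ?_ (by simp)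
    · rw [← he]
      exact List.prefix_append ..
    · rw [← List.append_assoc]
      exact List.prefix_append ..

theorem JumpsOver.unique {x u v u' v' : List α} (h : JumpsOver {x} x u) (h' : JumpsOver {x} x u')
    (he : u ++ x ++ v = u' ++ x ++ v') : u = u' ∧ v = v' := by
  have hl : u.length = u'.length := le_antisymm (h.length_le he) (h'.length_le he.symm)
  rw [List.append_assoc, List.append_assoc] at he
  obtain ⟨rfl, h2⟩ := List.append_inj he hl
  exact ⟨rfl, by simpa using h2⟩

/-- Since `u` is nonempty, `x₁` is a proper prefix and misses the last `d`. The word `u ++ x₁` then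
has fewer letters `d` than `y ++ [d]`. -/
theorem ne_of_notMem_getLast {d : α} {y u x₁ x₂ : List α} (hx : y ++ [d] = x₁ ++ x₂)
    (hne : u ≠ []) (hd : d ∉ u) : u ++ x₁ ≠ y ++ [d] := by
  classical
  intro h
  have h1 := congrArg List.length (h.trans hx)
  have h2 := congrArg (List.count d) (h.trans hx)
  simp only [List.length_append, List.count_append, List.count_eq_zero_of_not_mem hd] at h1 h2
  rcases List.eq_nil_or_concat x₂ with rfl | ⟨z, e, rfl⟩
  · have := List.length_pos_iff.2 hne
    simp only [List.length_nil] at h1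
    omega
  · rw [List.concat_eq_append, ← List.append_assoc] at hx
    have := (List.append_inj' hx rfl).2
    simp only [List.cons.injEq, and_true] at this
    subst this
    simp at h2

theorem jumpsOver_replicate {l l' : α} (hl : l ≠ l') (s t p : ℕ) :
    JumpsOver {List.replicate s l ++ List.replicate (t + 1) l'}
      (List.replicate s l ++ List.replicate (t + 1) l') (List.replicate p l) := by
  have hlast : List.replicate s l ++ List.replicate (t + 1) l' =
      (List.replicate s l ++ List.replicate t l') ++ [l'] := by
    rw [List.replicate_succ', List.append_assoc]
  refine ⟨?_, ?_⟩
  · rintro w rfl hw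
    have := hw.subset (a := l') (by simp)
    exact hl (List.eq_of_mem_replicate this).symm
  · intro u₁ u₂ x₁ x₂ hu hx hne _
    rw [hlast] at hx ⊢
    refine ne_of_notMem_getLast hx hne fun hm => ?_
    have : l' ∈ List.replicate p l := by rw [hu]; simp [hm]
    exact hl (List.eq_of_mem_replicate this).symm

/-- A nonempty suffix of the jumped-over word that begins like `x` begins with `l'`, hence lies in
the second block and contains no `l`, the last letter of `x`. -/
theorem jumpsOver_replicate_append {l l' : α} (hl : l ≠ l') (s t p q : ℕ) :
    JumpsOver {List.replicate (s + 1) l' ++ List.replicate (t + 1) l}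
      (List.replicate (s + 1) l' ++ List.replicate (t + 1) l)
      (List.replicate p l ++ List.replicate q l') := by
  have hlast : List.replicate (s + 1) l' ++ List.replicate (t + 1) l =
      (List.replicate (s + 1) l' ++ List.replicate t l) ++ [l] := by
    rw [List.replicate_succ' (n := t), List.append_assoc]
  refine ⟨?_, ?_⟩
  · rintro w rfl hw
    obtain ⟨i, j, h, -, -⟩ := eq_replicate_append_of_infix hw
    rcases i with _ | i
    · have : l ∈ List.replicate 0 l ++ List.replicate j l' := by rw [← h]; simp
      simp [hl] at this
    · simp [List.replicate_succ] at h
      exact hl h.1.symm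
  · intro u₁ u₂ x₁ x₂ hu hx hne _ hov
    revert hov
    have hhead : ∀ z, u₂ ++ z = List.replicate (s + 1) l' ++ List.replicate (t + 1) l → l ∉ u₂ := by
      intro z hz hm
      rw [eq_comm, List.append_eq_append_iff] at hu
      rcases hu with ⟨y, hy, rfl⟩ | ⟨y, rfl, hy⟩
      · rcases y with _ | ⟨c, y⟩
        · simp [hl] at hm
        · have : c ∈ List.replicate p l := by rw [hy]; simp
          have hc := List.eq_of_mem_replicate this
          simp [List.replicate_succ] at hz
          exact hl (hc.symm.trans hz.1)
      · have : l ∈ List.replicate q l' := by rw [hy]; simp [hm]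
        exact hl (List.eq_of_mem_replicate this)
    intro hov
    have hd := hhead _ hov
    rw [hlast] at hx hov
    exact ne_of_notMem_getLast hx hne hd hov

end Words

/-! ### Words made of alternating blocks -/

section AlternatingWords

variable {α : Type} (a b : α)

/-- The letters `a b a b …`. -/
def altLetter (i : ℕ) : α := if i % 2 = 0 then a else b

/-- The word with `L` alternating blocks of the letters `a` and `b`, beginning with the block with
number `k`; the block with number `i` has length `f i`. -/
def altWord (f : ℕ → ℕ) : ℕ → ℕ → List α
  | _, 0 => []
  | k, L + 1 => List.replicate (f k) (altLetter a b k) ++ altWord f (k + 1) L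

variable {a b}

theorem altLetter_add_two (i : ℕ) : altLetter a b (i + 2) = altLetter a b i := by
  simp [altLetter]

theorem altLetter_add_even {μ : ℕ} (hμ : μ % 2 = 0) (i : ℕ) :
    altLetter a b (i + μ) = altLetter a b i := by
  simp [altLetter, Nat.add_mod, hμ]

theorem altLetter_succ_ne (hab : a ≠ b) (i : ℕ) : altLetter a b i ≠ altLetter a b (i + 1) := by
  rcases Nat.mod_two_eq_zero_or_one i with h | h
  · simp [altLetter, h, Nat.add_mod, hab]
  · simp [altLetter, h, Nat.add_mod, hab.symm]

theorem altWord_succ (f : ℕ → ℕ) (k L : ℕ) : altWord a b f k (L + 1) =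
    List.replicate (f k) (altLetter a b k) ++ altWord a b f (k + 1) L := rfl

theorem altWord_succ_right (f : ℕ → ℕ) (k L : ℕ) : altWord a b f k (L + 1) =
    altWord a b f k L ++ List.replicate (f (k + L)) (altLetter a b (k + L)) := by
  induction L generalizing k with
  | zero => simp [altWord]
  | succ L ih =>
    rw [altWord, ih, altWord, List.append_assoc]
    congr 4 <;> ring

theorem altWord_add (f : ℕ → ℕ) (k L L' : ℕ) :
    altWord a b f k (L + L') = altWord a b f k L ++ altWord a b f (k + L) L' := by
  induction L generalizing k with
  | zero => simp [altWord]
  | succ L ih =>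
    rw [Nat.add_right_comm, altWord, ih, altWord, List.append_assoc]
    congr 3; ring

theorem altWord_congr {f g : ℕ → ℕ} {k L : ℕ} (h : ∀ i, k ≤ i → i < k + L → f i = g i) :
    altWord a b f k L = altWord a b g k L := by
  induction L generalizing k with
  | zero => rfl
  | succ L ih =>
    rw [altWord, altWord, h k le_rfl (by omega), ih fun i h1 h2 => h i (by omega) (by omega)]

theorem altWord_shift (f : ℕ → ℕ) {μ : ℕ} (hμ : μ % 2 = 0) (k L : ℕ) :
    altWord a b (fun i => f (i + μ)) k L = altWord a b f (k + μ) L := by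
  induction L generalizing k with
  | zero => rfl
  | succ L ih =>
    rw [altWord, altWord, ih, altLetter_add_even hμ, Nat.add_right_comm]

theorem altWord_ne_nil {f : ℕ → ℕ} {k L : ℕ} (hL : 0 < L) (hf : 0 < f k) :
    altWord a b f k L ≠ [] := by
  obtain ⟨L, rfl⟩ := Nat.exists_eq_succ_of_ne_zero hL.ne'
  rw [Nat.succ_eq_add_one, altWord]
  simp [hf.ne']

theorem exists_eq_replicate_of_infix_altWord {f : ℕ → ℕ} {k L m : ℕ} {x : List α}
    (hf : ∀ i, m ≤ f i) (hx : x.length ≤ m) (h : x <:+: altWord a b f k L) :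
    ∃ i s t, x = List.replicate s (altLetter a b i) ++ List.replicate t (altLetter a b (i + 1)) := by
  induction L generalizing k with
  | zero => exact ⟨0, 0, 0, by simpa [altWord] using h⟩
  | succ L ih =>
    rw [altWord] at h
    rcases List.infix_append_iff.1 h with h | h | ⟨y, z, rfl, hy, hz⟩
    · exact ⟨k, x.length, 0, by simpa using (List.infix_replicate_iff.1 h).2⟩
    · exact ih h
    · rcases L with _ | L
      · simp only [altWord, List.prefix_nil] at hz
        exact ⟨k, y.length, 0, by simpa [hz] using (List.suffix_replicate_iff.1 hy).2⟩
      · have hz' : z <+: List.replicate (f (k + 1)) (altLetter a b (k + 1)) := by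
          refine List.prefix_of_prefix_length_le hz (List.prefix_append _ _) ?_
          have := hf (k + 1)
          simp at hx ⊢
          omega
        exact ⟨k, y.length, z.length, by
          rw [← (List.suffix_replicate_iff.1 hy).2, ← (List.prefix_replicate_iff.1 hz').2]⟩

/-- The function that is `s` on the numbers congruent to `k` modulo `K`, and `0` elsewhere. -/
def residueIndicator (K k s : ℕ) (i : ℕ) : ℕ := if i % K = k % K then s else 0

theorem residueIndicator_periodic (K k s i : ℕ) :
    residueIndicator K k s (i + K) = residueIndicator K k s i := by
  simp [residueIndicator]

theorem residueIndicator_self (K k s : ℕ) : residueIndicator K k s k = s := by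
  simp [residueIndicator]

theorem residueIndicator_eq_zero {K k s i : ℕ} (h1 : i ≠ k) (h2 : i < k + K) (h3 : k < i + K) :
    residueIndicator K k s i = 0 := by
  rw [residueIndicator, if_neg]
  intro h
  rcases Nat.lt_or_gt_of_ne h1 with hlt | hlt
  · have := (Nat.modEq_iff_dvd' hlt.le).1 h
    have := Nat.le_of_dvd (by omega) this
    omega
  · have := (Nat.modEq_iff_dvd' hlt.le).1 h.symm
    have := Nat.le_of_dvd (by omega) this
    omega

end AlternatingWords

section AlternatingWords

variable {α : Type} {a b : α}

theorem altLetter_cases (a b : α) (i k : ℕ) :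
    (altLetter a b i = altLetter a b k ∧ altLetter a b (i + 1) = altLetter a b (k + 1)) ∨
      (altLetter a b i = altLetter a b (k + 1) ∧ altLetter a b (i + 1) = altLetter a b k) := by
  rcases Nat.mod_two_eq_zero_or_one i with h | h <;> rcases Nat.mod_two_eq_zero_or_one k with h' | h' <;>
    simp [altLetter, Nat.add_mod, h, h']

end AlternatingWords

/-! ### One step on a word with long blocks -/

namespace GCOWJFA

variable {α Q : Type} {A : GCOWJFA α Q} {a b : α} {K : ℕ}

/-- Uniqueness of the leftmost occurrence identifies the actual `u` with `U (f - c)`. A deletable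
word inside `U e` is short, so by `hinf` it would also be a factor of `U (f - c)`, whose blocks are
still long. Hence `e` needs no lower bound. -/
theorem exists_transfer_of_rightStep {p q : Q} {x u v : List α} {f c : ℕ → ℕ} {k k' : ℕ}
    (hf : ∀ i, f (i + K) = f i) (hlen : ∀ i, 2 * A.ruleBound ≤ f i)
    (hr : (p, x, q) ∈ A.rules) (hu : JumpsOver (A.deletable p) x u)
    (hw : altWord a b f k K = u ++ x ++ v)
    (hc : ∀ i, c (i + K) = c i) (hcle : ∀ i, c i ≤ A.ruleBound) (U V : (ℕ → ℕ) → List α)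
    (hUV : ∀ e : ℕ → ℕ, (∀ i, e (i + K) = e i) → altWord a b (e + c) k K = U e ++ x ++ V e ∧
      V e ++ U e = altWord a b e k' K)
    (hU : ∀ e, JumpsOver {x} x (U e))
    (hinf : ∀ (e e' : ℕ → ℕ) (w : List α), (∀ i, A.ruleBound ≤ e' i) → w.length ≤ A.ruleBound →
      w <:+: U e → w <:+: U e') :
    v ++ u = altWord a b (f - c) k' K ∧ ∀ e : ℕ → ℕ, (∀ i, e (i + K) = e i) →
      A.RightStep (p, altWord a b (e + c) k K) (q, altWord a b e k' K) := by
  have hper : ∀ i, (f - c) (i + K) = (f - c) i := fun i => by simp [hf, hc]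
  have hge : ∀ i, A.ruleBound ≤ (f - c) i := fun i => by
    have h1 := hlen i
    have h2 := hcle i
    simp only [Pi.sub_apply]
    omega
  have hadd : f - c + c = f := by
    funext i
    have h1 := hlen i
    have h2 := hcle i
    simp only [Pi.add_apply, Pi.sub_apply]
    omega
  obtain ⟨h1, h2⟩ := hUV (f - c) hper
  rw [hadd, hw] at h1
  obtain ⟨rfl, rfl⟩ := (hu.singleton ⟨q, hr⟩).unique (hU _) h1
  refine ⟨h2, fun e he => ?_⟩
  obtain ⟨h3, h4⟩ := hUV e he
  refine A.rightStep_iff.2 ⟨U e, x, V e, hr, h3, h4.symm, fun w hw h => ?_, (hU e).2⟩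
  exact hu.1 w hw (hinf _ _ _ hge (A.length_le_of_mem_deletable hw) h)

/-- A step on a word with long alternating blocks: it passes at most two blocks, and the same step
is possible for other block lengths. -/
theorem exists_deletion_of_rightStep (hab : a ≠ b) (hK : 4 ≤ K) (hK2 : K % 2 = 0) {f : ℕ → ℕ}
    (hf : ∀ i, f (i + K) = f i) (hlen : ∀ i, 2 * A.ruleBound ≤ f i) {p q : Q} {k : ℕ}
    {w' : List α} (h : A.RightStep (p, altWord a b f k K) (q, w')) :
    ∃ (c : ℕ → ℕ) (k' : ℕ), (∀ i, c (i + K) = c i) ∧ (∀ i, c i ≤ A.ruleBound) ∧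
      k ≤ k' ∧ k' ≤ k + 2 ∧ (k' = k → 0 < c k ∧ ∀ i, i % K ≠ k % K → c i = 0) ∧
      w' = altWord a b (f - c) k' K ∧ ∀ e : ℕ → ℕ, (∀ i, e (i + K) = e i) →
        A.RightStep (p, altWord a b (e + c) k K) (q, altWord a b e k' K) := by
  obtain ⟨u, x, v, hr, hw, rfl, hu⟩ := A.rightStep_iff.1 h
  simp only at hr hw hu
  have hxlen : x.length ≤ A.ruleBound := A.length_le_ruleBound hr
  have hxne : x ≠ [] := A.ne_nil _ _ _ hr
  obtain ⟨L, rfl⟩ : ∃ L, K = L + 3 := ⟨K - 3, by omega⟩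
  obtain ⟨i, s, t, hx⟩ := exists_eq_replicate_of_infix_altWord (f := f) (k := k) (L := L + 3)
    (fun i => by have := hlen i; omega) hxlen ⟨u, v, hw.symm⟩
  have hst : s + t = x.length := by simp [hx]
  have hpos := List.length_pos_iff.2 hxne
  have hl := altLetter_succ_ne hab k
  have hwrap : ∀ j, altLetter a b (j + (L + 3)) = altLetter a b j := altLetter_add_even hK2
  -- A power of the first letter is deleted at once and nothing is jumped over.
  have delete_front : ∀ s, 0 < s → s ≤ A.ruleBound → x = List.replicate s (altLetter a b k) →
      ∃ (c : ℕ → ℕ) (k' : ℕ), (∀ i, c (i + (L + 3)) = c i) ∧ (∀ i, c i ≤ A.ruleBound) ∧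
      k ≤ k' ∧ k' ≤ k + 2 ∧ (k' = k → 0 < c k ∧ ∀ i, i % (L + 3) ≠ k % (L + 3) → c i = 0) ∧
      v ++ u = altWord a b (f - c) k' (L + 3) ∧ ∀ e : ℕ → ℕ, (∀ i, e (i + (L + 3)) = e i) →
        A.RightStep (p, altWord a b (e + c) k (L + 3)) (q, altWord a b e k' (L + 3)) := by
    intro s hs hsm hx
    have hcle : ∀ i, residueIndicator (L + 3) k s i ≤ A.ruleBound := fun i => by
      simp only [residueIndicator]; split_ifs <;> omega
    refine ⟨residueIndicator (L + 3) k s, k, residueIndicator_periodic _ _ _, hcle, le_rfl,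
      by omega, fun _ => ⟨by rwa [residueIndicator_self], fun i hi => if_neg hi⟩, ?_⟩
    refine exists_transfer_of_rightStep hf hlen hr hu hw (residueIndicator_periodic _ _ _) hcle
      (fun _ => []) (fun e => altWord a b e k (L + 3)) (fun e he => ⟨?_, by simp⟩) (fun e => ?_)
      (fun e e' w _ _ h => h)
    · rw [altWord_succ _ k (L + 2), altWord_succ _ k (L + 2),
        altWord_congr (g := e) (k := k + 1) (fun i h1 h2 => ?_), hx, Pi.add_apply,
        residueIndicator_self, add_comm, List.replicate_add]
      · simp only [List.nil_append, List.append_assoc]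
      · simp [residueIndicator_eq_zero (K := L + 3) (show i ≠ k by omega) (by omega) (by omega)]
    · exact jumpsOver_nil (by simpa using hxne.symm)
  -- The occurrence is at the boundary of blocks `k` and `k + 1`; the rest of block `k` moves to the
  -- end as block `k + K`.
  have delete_next : ∀ s t, s + (t + 1) ≤ A.ruleBound →
      x = List.replicate s (altLetter a b k) ++ List.replicate (t + 1) (altLetter a b (k + 1)) →
      ∃ (c : ℕ → ℕ) (k' : ℕ), (∀ i, c (i + (L + 3)) = c i) ∧ (∀ i, c i ≤ A.ruleBound) ∧
      k ≤ k' ∧ k' ≤ k + 2 ∧ (k' = k → 0 < c k ∧ ∀ i, i % (L + 3) ≠ k % (L + 3) → c i = 0) ∧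
      v ++ u = altWord a b (f - c) k' (L + 3) ∧ ∀ e : ℕ → ℕ, (∀ i, e (i + (L + 3)) = e i) →
        A.RightStep (p, altWord a b (e + c) k (L + 3)) (q, altWord a b e k' (L + 3)) := by
    intro s t hstm hx
    have hper : ∀ i, (residueIndicator (L + 3) k s + residueIndicator (L + 3) (k + 1) (t + 1))
        (i + (L + 3)) = (residueIndicator (L + 3) k s +
          residueIndicator (L + 3) (k + 1) (t + 1)) i := fun i => by
      simp only [Pi.add_apply, residueIndicator_periodic]
    have hcle : ∀ i, (residueIndicator (L + 3) k s + residueIndicator (L + 3) (k + 1) (t + 1)) i ≤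
        A.ruleBound := fun i => by
      simp only [residueIndicator, Pi.add_apply]; split_ifs <;> omega
    refine ⟨residueIndicator (L + 3) k s + residueIndicator (L + 3) (k + 1) (t + 1), k + 1, hper,
      hcle, by omega, by omega, by omega, ?_⟩
    refine exists_transfer_of_rightStep hf hlen hr hu hw hper hcle
      (fun e => List.replicate (e k) (altLetter a b k)) (fun e => altWord a b e (k + 1) (L + 2))
      (fun e he => ⟨?_, ?_⟩) (fun e => ?_) (fun e e' w he' hw h => ?_)
    · rw [altWord_succ _ k (L + 2), altWord_succ _ (k + 1) (L + 1), altWord_succ e (k + 1) (L + 1),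
        altWord_congr (g := e) (k := k + 1 + 1) (fun i h1 h2 => ?_), hx]
      · simp only [Pi.add_apply, residueIndicator_self]
        rw [residueIndicator_eq_zero (K := L + 3) (show k ≠ k + 1 by omega) (by omega) (by omega),
          residueIndicator_eq_zero (K := L + 3) (show k + 1 ≠ k by omega) (by omega) (by omega), add_zero,
          zero_add, add_comm (e (k + 1)), List.replicate_add, List.replicate_add]
        simp only [List.append_assoc]
      · simp [residueIndicator_eq_zero (K := L + 3) (show i ≠ k by omega) (by omega) (by omega),
          residueIndicator_eq_zero (K := L + 3) (show i ≠ k + 1 by omega) (by omega) (by omega)]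
    · rw [altWord_succ_right e (k + 1) (L + 2), show k + 1 + (L + 2) = k + (L + 3) by ring, he,
        hwrap]
    · rw [hx]
      exact jumpsOver_replicate hl s t _
    · obtain ⟨h1, h2⟩ := List.infix_replicate_iff.1 h
      exact List.infix_replicate_iff.2 ⟨hw.trans (he' k), h2⟩
  -- The letters come in the opposite order, so the first boundary does not fit and the deletion is
  -- at the boundary of blocks `k + 1` and `k + 2`.
  have delete_after_next : ∀ s t, (s + 1) + (t + 1) ≤ A.ruleBound →
      x = List.replicate (s + 1) (altLetter a b (k + 1)) ++
        List.replicate (t + 1) (altLetter a b k) →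
      ∃ (c : ℕ → ℕ) (k' : ℕ), (∀ i, c (i + (L + 3)) = c i) ∧ (∀ i, c i ≤ A.ruleBound) ∧
      k ≤ k' ∧ k' ≤ k + 2 ∧ (k' = k → 0 < c k ∧ ∀ i, i % (L + 3) ≠ k % (L + 3) → c i = 0) ∧
      v ++ u = altWord a b (f - c) k' (L + 3) ∧ ∀ e : ℕ → ℕ, (∀ i, e (i + (L + 3)) = e i) →
        A.RightStep (p, altWord a b (e + c) k (L + 3)) (q, altWord a b e k' (L + 3)) := by
    intro s t hstm hx
    have hper : ∀ i, (residueIndicator (L + 3) (k + 1) (s + 1) +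
        residueIndicator (L + 3) (k + 2) (t + 1)) (i + (L + 3)) =
        (residueIndicator (L + 3) (k + 1) (s + 1) +
          residueIndicator (L + 3) (k + 2) (t + 1)) i := fun i => by
      simp only [Pi.add_apply, residueIndicator_periodic]
    have hcle : ∀ i, (residueIndicator (L + 3) (k + 1) (s + 1) +
        residueIndicator (L + 3) (k + 2) (t + 1)) i ≤ A.ruleBound := fun i => by
      simp only [residueIndicator, Pi.add_apply]; split_ifs <;> omega
    refine ⟨residueIndicator (L + 3) (k + 1) (s + 1) + residueIndicator (L + 3) (k + 2) (t + 1),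
      k + 2, hper, hcle, by omega, by omega, by omega, ?_⟩
    refine exists_transfer_of_rightStep hf hlen hr hu hw hper hcle
      (fun e => List.replicate (e k) (altLetter a b k) ++
        List.replicate (e (k + 1)) (altLetter a b (k + 1)))
      (fun e => altWord a b e (k + 2) (L + 1))
      (fun e he => ⟨?_, ?_⟩) (fun e => ?_) (fun e e' w he' hw h => ?_)
    · rw [altWord_succ _ k (L + 2), altWord_succ _ (k + 1) (L + 1),
        altWord_succ _ (k + 1 + 1) L, altWord_succ e (k + 2) L,
        altWord_congr (g := e) (k := k + 1 + 1 + 1) (fun i h1 h2 => ?_), hx]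
      · simp only [Pi.add_apply, residueIndicator_self, show k + 1 + 1 = k + 2 from rfl]
        rw [residueIndicator_eq_zero (K := L + 3) (show k ≠ k + 1 by omega) (by omega) (by omega),
          residueIndicator_eq_zero (K := L + 3) (show k ≠ k + 2 by omega) (by omega) (by omega),
          residueIndicator_eq_zero (K := L + 3) (show k + 1 ≠ k + 2 by omega) (by omega) (by omega),
          residueIndicator_eq_zero (K := L + 3) (show k + 2 ≠ k + 1 by omega) (by omega) (by omega),
          altLetter_add_two]
        simp only [add_zero, zero_add]
        rw [add_comm (e (k + 2)), List.replicate_add (m := e (k + 1)),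
          List.replicate_add (m := t + 1)]
        simp only [List.append_assoc]
      · simp [residueIndicator_eq_zero (K := L + 3) (show i ≠ k + 1 by omega) (by omega) (by omega),
          residueIndicator_eq_zero (K := L + 3) (show i ≠ k + 2 by omega) (by omega) (by omega)]
    · rw [altWord_succ_right e (k + 2) (L + 2), altWord_succ_right e (k + 2) (L + 1),
        show k + 2 + (L + 1) = k + (L + 3) by ring,
        show k + 2 + (L + 2) = k + 1 + (L + 3) by ring, he, he, hwrap, hwrap, List.append_assoc]
    · rw [hx]
      exact jumpsOver_replicate_append hl s t _ _
    · obtain ⟨s', t', rfl, -, -⟩ := eq_replicate_append_of_infix h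
      simp only [List.length_append, List.length_replicate] at hw
      exact replicate_append_infix ((by omega : s' ≤ _).trans (he' k))
        ((by omega : t' ≤ _).trans (he' (k + 1)))
  rcases altLetter_cases a b i k with ⟨h1, h2⟩ | ⟨h1, h2⟩ <;> rw [h1, h2] at hx
  · rcases t with _ | t
    · exact delete_front s (by omega) (by omega) (by simpa using hx)
    · exact delete_next s t (by omega) hx
  · rcases s with _ | s
    · exact delete_front t (by omega) (by omega) (by simpa using hx)
    · rcases t with _ | t
      · exact delete_next 0 s (by omega) (by simpa using hx)
      · exact delete_after_next s t (by omega) hx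

end GCOWJFA

/-! ### Cutting a piece out of an accepting run -/

namespace GCOWJFA

variable {α Q : Type} {A : GCOWJFA α Q} {a b : α} {K : ℕ}

/-- Invariant of a run on `altWord a b f 0 K` after `t` steps: `p` is the state, `k` is the number
of the first block, and `d` are the numbers of deleted letters. -/
structure RunStage (A : GCOWJFA α Q) (a b : α) (K : ℕ) (f : ℕ → ℕ) (t : ℕ) (p : Q) (k : ℕ)
    (d : ℕ → ℕ) : Prop where
  periodic : ∀ i, d (i + K) = d i
  le : ∀ i, d i ≤ t * A.ruleBound
  shift_le : k ≤ 2 * t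
  reach : ∀ e : ℕ → ℕ, (∀ i, e (i + K) = e i) →
    ReflTransGen A.RightStep (A.start, altWord a b (e + d) 0 K) (p, altWord a b e k K)
  accepts : A.RightAccepts p (altWord a b (f - d) k K)

/-- How two stages of a run are related if at least one step lies between them. -/
def StageLT (K k : ℕ) (d : ℕ → ℕ) (k' : ℕ) (d' : ℕ → ℕ) : Prop :=
  k ≤ k' ∧ (∀ i, d i ≤ d' i) ∧ (k' = k → d k < d' k ∧ ∀ i, i % K ≠ k % K → d i = d' i)

theorem StageLT.trans {k k' k'' : ℕ} {d d' d'' : ℕ → ℕ} (h : StageLT K k d k' d')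
    (h' : StageLT K k' d' k'' d'') : StageLT K k d k'' d'' := by
  refine ⟨h.1.trans h'.1, fun i => (h.2.1 i).trans (h'.2.1 i), fun he => ?_⟩
  have h1 : k' = k := le_antisymm (he ▸ h'.1) h.1
  subst h1
  obtain ⟨h2, h3⟩ := h.2.2 rfl
  obtain ⟨h4, h5⟩ := h'.2.2 he
  exact ⟨h2.trans h4, fun i hi => (h3 i hi).trans (h5 i hi)⟩

theorem RunStage.exists_next (hab : a ≠ b) (hK : 4 ≤ K) (hK2 : K % 2 = 0) {f : ℕ → ℕ}
    (hf : ∀ i, f (i + K) = f i) {T : ℕ} (hlen : ∀ i, (T + 2) * A.ruleBound < f i) {t : ℕ}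
    (ht : t < T) {p : Q} {k : ℕ} {d : ℕ → ℕ} (h : RunStage A a b K f t p k d) :
    ∃ p' k' d', RunStage A a b K f (t + 1) p' k' d' ∧ StageLT K k d k' d' := by
  obtain ⟨g, hg, hacc⟩ := h.accepts
  -- Before step `t < T` every block has lost at most `t * A.ruleBound` letters and still has more
  -- than `2 * A.ruleBound`. In particular the run has not ended.
  have hmul : t * A.ruleBound + 2 * A.ruleBound ≤ (T + 2) * A.ruleBound := by
    rw [← add_mul]
    exact Nat.mul_le_mul_right _ (by omega)
  have hfd : ∀ i, 2 * A.ruleBound < (f - d) i := fun i => by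
    have h1 := hlen i
    have h2 := h.le i
    simp only [Pi.sub_apply]
    omega
  rcases ReflTransGen.cases_head hacc with heq | ⟨⟨p', w'⟩, hs, hacc⟩
  · have h1 := (Prod.mk.inj heq).2
    exact absurd h1 (altWord_ne_nil (by omega) (by have := hfd k; omega))
  · obtain ⟨c, k', hc, hcle, hk1, hk2, hk3, rfl, hstep⟩ := exists_deletion_of_rightStep hab hK hK2
      (f := f - d) (fun i => by simp [hf, h.periodic]) (fun i => (hfd i).le) hs
    refine ⟨p', k', d + c, ⟨fun i => by simp [hc, h.periodic], fun i => ?_, ?_, fun e he => ?_,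
      ⟨g, hg, ?_⟩⟩, hk1, fun i => by simp, fun he => ?_⟩
    · have h1 := h.le i
      have h2 := hcle i
      rw [add_mul, one_mul, Pi.add_apply]
      omega
    · have := h.shift_le
      omega
    · have h1 := h.reach (e + c) fun i => by simp [hc, he]
      rw [add_assoc, add_comm c d] at h1
      exact h1.tail (hstep e he)
    · have : f - (d + c) = f - d - c := by
        funext i
        simp [Nat.sub_sub]
      rw [this]
      exact hacc
    · obtain ⟨h1, h2⟩ := hk3 he
      exact ⟨by simpa using h1, fun i hi => by simp [h2 i hi]⟩

/-- Leaving out a part of a run that begins and ends in the same state: an accepted word with long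
alternating blocks is turned into another one, with the blocks rotated and slightly changed. -/
theorem exists_rotation_mem_rightLanguage [Finite Q] (hab : a ≠ b) (hK : 4 ≤ K) (hK2 : K % 2 = 0)
    {f : ℕ → ℕ} (hf : ∀ i, f (i + K) = f i)
    (hlen : ∀ i, (2 * Nat.card Q + 2) * A.ruleBound < f i)
    (h : altWord a b f 0 K ∈ A.rightLanguage) :
    ∃ (μ : ℕ) (d d' : ℕ → ℕ), μ % 2 = 0 ∧ μ ≤ 4 * Nat.card Q ∧
      (∀ i, d i ≤ 2 * Nat.card Q * A.ruleBound) ∧ (∀ i, d' i ≤ 2 * Nat.card Q * A.ruleBound) ∧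
      (μ = 0 → (∀ i, d i ≤ d' i) ∧ ∃ k, d k < d' k ∧ ∀ i, i % K ≠ k % K → d i = d' i) ∧
      (∀ i, d (i + K) = d i) ∧ (∀ i, d' (i + K) = d' i) ∧
      altWord a b (fun i => (f (i + μ) - d' (i + μ)) + d i) 0 K ∈ A.rightLanguage := by
  set T := 2 * Nat.card Q with hT
  have hstep : ∀ (t : ℕ) (x : Q × ℕ × (ℕ → ℕ)), ∃ y : Q × ℕ × (ℕ → ℕ), t < T →
      RunStage A a b K f t x.1 x.2.1 x.2.2 → RunStage A a b K f (t + 1) y.1 y.2.1 y.2.2 ∧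
        StageLT K x.2.1 x.2.2 y.2.1 y.2.2 := by
    intro t x
    by_cases hx : t < T ∧ RunStage A a b K f t x.1 x.2.1 x.2.2
    · obtain ⟨p', k', d', h1, h2⟩ := hx.2.exists_next hab hK hK2 hf hlen hx.1
      exact ⟨(p', k', d'), fun _ _ => ⟨h1, h2⟩⟩
    -- A default value that makes the successor total, so that it can be iterated.
    · exact ⟨x, fun h1 h2 => absurd ⟨h1, h2⟩ hx⟩
  choose next hnext using hstep
  let S : ℕ → Q × ℕ × (ℕ → ℕ) := Nat.rec (A.start, 0, 0) next
  have hS : ∀ t ≤ T, RunStage A a b K f t (S t).1 (S t).2.1 (S t).2.2 := by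
    intro t
    induction t with
    | zero =>
      intro _
      refine ⟨fun i => rfl, fun i => Nat.zero_le _, le_rfl, fun e _ => .refl, ?_⟩
      change A.RightAccepts A.start (altWord a b (f - 0) 0 K)
      rw [tsub_zero]
      exact h
    | succ t ih => exact fun ht => (hnext t (S t) (by omega) (ih (by omega))).1
  have hlt : ∀ s t, s < t → t ≤ T → StageLT K (S s).2.1 (S s).2.2 (S t).2.1 (S t).2.2 := by
    intro s t hst
    induction t, hst using Nat.le_induction with
    | base => exact fun ht => (hnext s (S s) (by omega) (hS s (by omega))).2
    | succ t hst ih =>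
      exact fun ht => (ih (by omega)).trans (hnext t (S t) (by omega) (hS t (by omega))).2
  -- There are `T + 1` stages and only `T` pairs of a state and a parity. Equal parity is needed
  -- because only an even shift of the block numbers preserves the letters.
  obtain ⟨s, t, hst, htT, hp, hmod⟩ : ∃ s t, s < t ∧ t ≤ T ∧ (S s).1 = (S t).1 ∧
      (S s).2.1 % 2 = (S t).2.1 % 2 := by
    have := Fintype.ofFinite Q
    have hcard : Fintype.card (Q × Fin 2) < Fintype.card (Fin (T + 1)) := by
      rw [Fintype.card_prod, Fintype.card_fin, Fintype.card_fin, hT, Nat.card_eq_fintype_card]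
      omega
    obtain ⟨i, j, hij, he⟩ := Fintype.exists_ne_map_eq_of_card_lt
      (fun t : Fin (T + 1) => ((S t).1, (⟨(S t).2.1 % 2, Nat.mod_lt _ two_pos⟩ : Fin 2))) hcard
    simp only [Prod.mk.injEq, Fin.mk.injEq] at he
    rcases Nat.lt_or_gt_of_ne (Fin.val_ne_of_ne hij) with h1 | h1
    · exact ⟨i, j, h1, by omega, he⟩
    · exact ⟨j, i, h1, by omega, he.1.symm, he.2.symm⟩
  obtain ⟨hk, hd, hd0⟩ := hlt s t hst htT
  have hs := hS s (by omega)
  have ht := hS t htT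
  obtain ⟨μ, hμ⟩ := Nat.exists_eq_add_of_le hk
  have hμ2 : μ % 2 = 0 := by omega
  refine ⟨μ, (S s).2.2, (S t).2.2, hμ2, ?_, fun i => (hs.le i).trans
    (Nat.mul_le_mul_right _ (by omega)), fun i => (ht.le i).trans (Nat.mul_le_mul_right _ htT),
    fun h0 => ⟨hd, (S s).2.1, hd0 (by omega)⟩, hs.periodic, ht.periodic, ?_⟩
  · have := ht.shift_le
    omega
  · obtain ⟨g, hg, hacc⟩ := ht.accepts
    -- The run up to stage `s` is replayed with the remaining lengths chosen so that it ends in the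
    -- configuration of stage `t`, from which the original run continues.
    refine ⟨g, hg, (hs.reach (fun i => (f - (S t).2.2) (i + μ)) fun i => ?_).trans ?_⟩
    · rw [Nat.add_right_comm]
      simp [hf, ht.periodic]
    · rw [altWord_shift _ hμ2, ← hμ, hp]
      exact hacc

end GCOWJFA

/-! ### The Dyck language is not accepted -/

section DyckBlocks

variable {α : Type} {a b : α}

theorem count_le_count_of_prefix_mem_dyckLanguage [DecidableEq α] (hab : a ≠ b) {u v : List α}
    (h : u ++ v ∈ dyckLanguage a b) : u.count b ≤ u.count a := by
  have hinj : Function.Injective (dyckLetter a b) := by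
    rintro (_ | _) (_ | _) h
    exacts [rfl, absurd h hab, absurd h.symm hab, rfl]
  obtain ⟨d, hd⟩ := mem_dyckLanguage.1 h
  have hu : u = (d.toList.take u.length).map (dyckLetter a b) := by
    rw [List.map_take, ← hd, List.take_left']
    rfl
  have h1 := List.count_map_of_injective (d.toList.take u.length) _ hinj DyckStep.U
  have h2 := List.count_map_of_injective (d.toList.take u.length) _ hinj DyckStep.D
  rw [← hu] at h1 h2
  exact (h2.trans_le (d.count_D_le_count_U _)).trans_eq h1.symm

theorem count_eq_count_of_mem_dyckLanguage [DecidableEq α] (hab : a ≠ b) {w : List α}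
    (h : w ∈ dyckLanguage a b) : w.count a = w.count b := by
  induction h using dyckLanguage_induction with
  | nil => rfl
  | nest w w' _ _ ih ih' =>
    simp [ih, ih', hab, hab.symm]
    ring

theorem replicate_append_mem_dyckLanguage {w : List α} (h : w ∈ dyckLanguage a b) (n : ℕ) :
    List.replicate n a ++ (w ++ List.replicate n b) ∈ dyckLanguage a b := by
  induction n with
  | zero => simpa using h
  | succ n ih =>
    have := nest_mem_dyckLanguage ih
    rw [List.replicate_succ' (a := b)]
    simpa [List.replicate_succ] using this

theorem altWord_const_mem_dyckLanguage (N k j : ℕ) (hk : k % 2 = 0) :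
    altWord a b (fun _ => N) k (2 * j) ∈ dyckLanguage a b := by
  induction j generalizing k with
  | zero => exact nil_mem_dyckLanguage
  | succ j ih =>
    have h1 := replicate_append_mem_dyckLanguage (nil_mem_dyckLanguage (a := a) (b := b)) N
    have h2 := append_mem_dyckLanguage h1 (ih (k + 1 + 1) (by omega))
    rw [show 2 * (j + 1) = 2 * j + 1 + 1 by ring, altWord_succ, altWord_succ]
    simpa [altLetter, hk, Nat.add_mod] using h2

/-- Block lengths `N`, except for the first and the last of `K` blocks, which are longer. -/
def longEnds (N P K i : ℕ) : ℕ := if i % K = 0 ∨ i % K = K - 1 then P + N else N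

theorem altWord_longEnds_mem_dyckLanguage (N P : ℕ) {K : ℕ} (hK : 2 ≤ K) (hK2 : K % 2 = 0) :
    altWord a b (longEnds N P K) 0 K ∈ dyckLanguage a b := by
  obtain ⟨j, rfl⟩ : ∃ j, K = 2 * j + 2 := ⟨K / 2 - 1, by omega⟩
  have h := replicate_append_mem_dyckLanguage
    (altWord_const_mem_dyckLanguage (a := a) (b := b) N 0 (j + 1) rfl) P
  have hc : altWord a b (longEnds N P (2 * j + 2)) (0 + 1) (2 * j) =
      altWord a b (fun _ => N) (0 + 1) (2 * j) := by
    refine altWord_congr fun i h1 h2 => ?_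
    rw [longEnds, if_neg]
    rw [Nat.mod_eq_of_lt (by omega)]
    omega
  have h0 : altLetter a b 0 = a := rfl
  have hl : altLetter a b (0 + 1 + 2 * j) = b := by
    rw [altLetter, if_neg (by omega)]
  have e1 : longEnds N P (2 * j + 2) 0 = P + N := by simp [longEnds]
  have e2 : longEnds N P (2 * j + 2) (0 + 1 + 2 * j) = N + P := by
    rw [longEnds, if_pos, add_comm]
    rw [Nat.mod_eq_of_lt (by omega)]
    omega
  rw [show 2 * (j + 1) = 2 * j + 1 + 1 by ring, altWord_succ, altWord_succ_right, h0, hl] at h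
  rw [altWord_succ, altWord_succ_right, h0, hl, hc, e1, e2, List.replicate_add, List.replicate_add]
  simpa only [List.append_assoc] using h

theorem count_altWord_le [DecidableEq α] (hab : a ≠ b) {g : ℕ → ℕ} {M k L : ℕ}
    (h : ∀ i, k ≤ i → i < k + L → i % 2 = 0 → g i ≤ M) :
    (altWord a b g k L).count a ≤ L * M := by
  induction L generalizing k with
  | zero => simp [altWord]
  | succ L ih =>
    have h1 := ih (k := k + 1) fun i h1 h2 => h i (by omega) (by omega)
    rw [altWord_succ, List.count_append, add_mul, one_mul, add_comm]
    refine add_le_add h1 ?_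
    rcases Nat.mod_two_eq_zero_or_one k with hk | hk
    · have := h k le_rfl (by omega) hk
      simpa [altLetter, hk] using this
    · simp [altLetter, hk, hab.symm, List.count_replicate]

theorem count_altWord_sub [DecidableEq α] (hab : a ≠ b) (g : ℕ → ℕ) (L : ℕ) :
    ((altWord a b g 0 L).count a : ℤ) - (altWord a b g 0 L).count b =
      ∑ i ∈ Finset.range L, (-1) ^ i * (g i : ℤ) := by
  induction L with
  | zero => simp [altWord]
  | succ L ih =>
    rw [altWord_succ_right, Finset.sum_range_succ, ← ih, List.count_append, List.count_append,
      zero_add]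
    rcases Nat.mod_two_eq_zero_or_one L with hL | hL
    · simp [altLetter, hL, hab, List.count_replicate, (Nat.even_iff.2 hL).neg_one_pow]
      ring
    · simp [altLetter, hL, hab.symm, List.count_replicate, (Nat.odd_iff.2 hL).neg_one_pow]
      ring

theorem dyckLanguage_notMem_GRCOWJ (hab : a ≠ b) : dyckLanguage a b ∉ GRCOWJ α := by
  classical
  rintro ⟨Q, _, A, hA⟩
  set T := 2 * Nat.card Q with hT
  set m := A.ruleBound with hm
  -- The rotation satisfies `μ ≤ 2 * T < K`, so it does not come full circle. `N` makes the blocks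
  -- long enough for the cutting argument. `P` exceeds, even after a loss of `T * m`, all letters
  -- `a` that blocks of length at most `N + T * m` can supply.
  set K := 2 * T + 4 with hKdef
  set N := (T + 2) * m + 1 with hN
  set P := K * (N + T * m) + T * m + 1 with hP
  have hK2 : K % 2 = 0 := by omega
  have hper : ∀ i, longEnds N P K (i + K) = longEnds N P K i := fun i => by simp [longEnds]
  have hge : ∀ i, N ≤ longEnds N P K i := fun i => by
    rw [longEnds]; split_ifs <;> omega
  have hTm : T * m ≤ N := by
    rw [hN, add_mul]; omega
  have hmem := altWord_longEnds_mem_dyckLanguage (a := a) (b := b) N P (K := K) (by omega) hK2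
  obtain ⟨μ, d, d', hμ2, hμ, hd, hd', h0, hdper, hd'per, hrot⟩ :=
    GCOWJFA.exists_rotation_mem_rightLanguage (A := A) hab (K := K) (by omega) hK2 hper
      (fun i => (Nat.lt_succ_self _).trans_le (hge i)) (hA ▸ hmem)
  rw [hA] at hrot
  replace hd : ∀ i, d i ≤ T * m := hd
  replace hd' : ∀ i, d' i ≤ T * m := hd'
  rcases Nat.eq_zero_or_pos μ with rfl | hpos
  · obtain ⟨hle, k, hk, hne⟩ := h0 rfl
    have hc1 := count_altWord_sub hab (longEnds N P K) K
    have hc2 := count_altWord_sub hab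
      (fun i => (longEnds N P K (i + 0) - d' (i + 0)) + d i) K
    rw [count_eq_count_of_mem_dyckLanguage hab hmem, sub_self] at hc1
    rw [count_eq_count_of_mem_dyckLanguage hab hrot, sub_self] at hc2
    have hmodper : ∀ g : ℕ → ℕ, (∀ i, g (i + K) = g i) → g (k % K) = g k := fun g hg =>
      Function.Periodic.map_mod_nat (f := g) hg k
    -- Both words balance, so the alternating sum of the changes in block length vanishes. Only the
    -- block `k % K` has changed, and this is a contradiction.
    have hsum : ∑ i ∈ Finset.range K, (-1 : ℤ) ^ i * ((d' i : ℤ) - d i) = 0 := by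
      rw [← sub_eq_zero.2 (hc1.symm.trans hc2), ← Finset.sum_sub_distrib]
      refine Finset.sum_congr rfl fun i _ => ?_
      have h1 := hge i
      have h2 := hd' i
      have h3 : d' i ≤ longEnds N P K i := by omega
      push_cast [add_zero, Nat.cast_sub h3]
      ring
    rw [Finset.sum_eq_single (k % K)] at hsum
    · rw [hmodper d hdper, hmodper d' hd'per] at hsum
      rcases mul_eq_zero.1 hsum with h | h
      · exact absurd h (pow_ne_zero _ (by norm_num))
      · omega
    · intro i hi hik
      rw [hne i, sub_self, mul_zero]
      rwa [Nat.mod_eq_of_lt (Finset.mem_range.1 hi)]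
    · intro h
      exact absurd (Finset.mem_range.2 (Nat.mod_lt _ (by omega))) h
  · set g : ℕ → ℕ := fun i => (longEnds N P K (i + μ) - d' (i + μ)) + d i with hg
    have hμK : μ + 4 ≤ K := by omega
    -- After the rotation the last long block, of letters `b`, has the number `L`, and the long
    -- block of letters `a` comes right after it. The prefix ending with block `L` violates the Dyck
    -- condition.
    obtain ⟨L, hL⟩ : ∃ L, K = L + 1 + μ := ⟨K - 1 - μ, by omega⟩
    rw [show altWord a b g 0 K = altWord a b g 0 (L + 1) ++ altWord a b g (0 + (L + 1)) μ by
      rw [← altWord_add, ← hL]] at hrot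
    have hpre := count_le_count_of_prefix_mem_dyckLanguage hab hrot
    have ha : (altWord a b g 0 (L + 1)).count a ≤ (L + 1) * (N + T * m) := by
      refine count_altWord_le hab fun i _ hi hi2 => ?_
      -- For even `i`, the number `i + μ` is positive, even and less than `K`, so it is neither `0`
      -- nor the odd number `K - 1`.
      have h1 : longEnds N P K (i + μ) = N := by
        rw [longEnds, if_neg]
        rw [Nat.mod_eq_of_lt (by omega)]
        omega
      have h2 := hd i
      simp only [hg, h1]
      omega
    have hb : P + N - T * m ≤ (altWord a b g 0 (L + 1)).count b := by
      have h1 : longEnds N P K (L + μ) = P + N := by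
        rw [longEnds, if_pos]
        rw [Nat.mod_eq_of_lt (by omega)]
        omega
      have h2 := hd' (L + μ)
      have h3 : altLetter a b (0 + L) = b := by
        rw [altLetter, if_neg (by omega)]
      rw [altWord_succ_right, List.count_append, h3, List.count_replicate_self, zero_add]
      simp only [hg, h1]
      omega
    have hmul : (L + 1) * (N + T * m) ≤ K * (N + T * m) := Nat.mul_le_mul_right _ (by omega)
    omega

theorem dyckLanguage_notMem_GLCOWJ (hab : a ≠ b) : dyckLanguage a b ∉ GLCOWJ α := fun h => by
  have := reverse_mem_GRCOWJ h
  rw [dyckLanguage_reverse] at this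
  exact dyckLanguage_notMem_GRCOWJ hab.symm this

end DyckBlocks

theorem mainTheorem9 (α : Type) [Finite α] :
    (GRCOWJ α ⊆ CS α ∧ GLCOWJ α ⊆ CS α) ∧
    (∀ a b : α, a ≠ b →
      dyckLanguage a b ∈ CS α ∧ dyckLanguage a b ∉ GRCOWJ α ∧ dyckLanguage a b ∉ GLCOWJ α) ∧
    (Nontrivial α → GRCOWJ α ⊂ CS α ∧ GLCOWJ α ⊂ CS α) := by
  refine ⟨⟨GRCOWJ_subset_CS, GLCOWJ_subset_CS⟩, fun a b hab => ⟨dyckLanguage_mem_CS a b,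
    dyckLanguage_notMem_GRCOWJ hab, dyckLanguage_notMem_GLCOWJ hab⟩, fun _ => ?_⟩
  obtain ⟨a, b, hab⟩ := exists_pair_ne α
  exact ⟨⟨GRCOWJ_subset_CS, fun h => dyckLanguage_notMem_GRCOWJ hab (h (dyckLanguage_mem_CS a b))⟩,
    ⟨GLCOWJ_subset_CS, fun h => dyckLanguage_notMem_GLCOWJ hab (h (dyckLanguage_mem_CS a b))⟩⟩
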